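/- Let $Y_1,Y_2,\dots$ be independent copies of a real random variable $Y$ with a continuous distribution function $G$, and put $l_G=\inf\{x: G(x)>0\}$, $r_G=\sup\{x: G(x)<1\}$ (extended real numbers). Define the upper record times by $L(1)=1$, $L(n)=\min\{j>L(n-1): Y_j>Y_{L(n-1)}\}$ for $n>1$, and the upper record values by $Y(n)=Y_{L(n)}$. Let $g$ be strictly decreasing on $(l_G,r_G)$ and such that the function $T(y)=g(y)^{-2}$ is (finite,) continuous and strictly increasing on $(l_G,r_G)$, with a finite right limit $\tau=\lim_{y\downarrow l_G}g(y)^{-2}$ at $l_G$ and with $\lim_{y\uparrow r_G}g(y)^{-2}=\infty$. Let $n\ge 2$. Then $$E[g(Y(n))\mid Y(n-1)=s,\ Y(n+1)=t]=\frac{2g(s)g(t)}{g(s)+g(t)}\qquad (l_G<s<t<r_G)$$ holds (for almost all $(s,t)$ with respect to the law of $(Y(n-1),Y(n+1))$, the regression function being determined up to null sets only) if and only if there is a constant $c>0$ such that $$G(y)=1-\exp\bigl(-c\{g(y)^{-2}-\tau\}\bigr)\qquad (l_G<y<r_G).$$ -/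

import Mathlib

open MeasureTheory ProbabilityTheory Filter Topology

noncomputable section

/-- Upper record times of the sequence `x 0, x 1, …`, counted from `0`: the first observation is
the record number `0`, and the next record time is the least later index whose observation exceeds
the current record strictly. (For i.i.d. observations with a continuous distribution function the
set below is almost surely nonempty.) -/
def recordTime (x : ℕ → ℝ) : ℕ → ℕ
  | 0 => 0
  | m + 1 => sInf {j : ℕ | recordTime x m < j ∧ x (recordTime x m) < x j}

/-- The `n`-th upper record value, counted from `n = 1` (the first observation is the first
record). -/
def recordValue (x : ℕ → ℝ) (n : ℕ) : ℝ := x (recordTime x (n - 1))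

/-- The left extremity `inf {x | 0 < G x}`, an extended real number. -/
def leftExtremity (G : ℝ → ℝ) : EReal := sInf (Real.toEReal '' {x : ℝ | 0 < G x})

/-- The right extremity `sup {x | G x < 1}`, an extended real number. -/
def rightExtremity (G : ℝ → ℝ) : EReal := sSup (Real.toEReal '' {x : ℝ | G x < 1})

/-- The real points of the open interval between two extended real numbers. -/
def openInterval (a b : EReal) : Set ℝ := {x : ℝ | a < (x : EReal) ∧ (x : EReal) < b}

/-- Real numbers tending to the extended real number `a` from the right. -/
def rightLimitFilter (a : EReal) : Filter ℝ := comap Real.toEReal (𝓝[>] a)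

/-- Real numbers tending to the extended real number `b` from the left. -/
def leftLimitFilter (b : EReal) : Filter ℝ := comap Real.toEReal (𝓝[<] b)

/-- `E[g(V) | U = s, W = t] = φ(s, t)` for `a < s < t < b`. The regression function is the integral
of `g` against the regular conditional distribution of `V` given `(U, W)`; as such it is determined
up to null sets of the law of `(U, W)`. -/
def HasRegression {Ω : Type*} [MeasurableSpace Ω] (μ : Measure Ω) [IsFiniteMeasure μ]
    (g : ℝ → ℝ) (V U W : Ω → ℝ) (a b : EReal) (φ : ℝ → ℝ → ℝ) : Prop :=
  ∀ᵐ p ∂(μ.map (fun ω => (U ω, W ω))),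
    a < (p.1 : EReal) → p.1 < p.2 → (p.2 : EReal) < b →
      Integrable g (condDistrib V (fun ω => (U ω, W ω)) μ p) ∧
        ∫ y, g y ∂(condDistrib V (fun ω => (U ω, W ω)) μ p) = φ p.1 p.2

end

/-! Put `H = -log (1 - G)` and `w = 1 / g`. Records form a Markov chain whose next value, from level
`s`, has law `ν` conditioned to `(s, ∞)`. Hence, given both neighbours `s < t`, the middle record is
distributed as the hazard measure `dH = dν / ν(v, ∞)` normalised on `(s, t)`
(`lintegral_record_triple`, `hasRegression_record_iff`). With `K` a primitive of `g dH`, the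
regression identity becomes `(K t - K s) (w s + w t) = 2 (H t - H s)`.

Writing this for three points and using additivity of `K` and `H` eliminates `K`: increments of `H`
are proportional to those of `w ^ 2` (`sq_proportional_of_three_points`). So `H = c w ^ 2 + d`, at
first almost everywhere (`exists_ae_hazard_affine`), then everywhere by monotonicity and continuity
of `G` (`hazard_affine_of_ae`). At the left extremity `H → 0` and `w ^ 2 → τ`, so `d = -c τ`.

Conversely `H = c w ^ 2 + d` gives `g dH = 2 c dw`, and `2 c (w t - w s)` divided by `c (w t ^ 2 - w
s ^ 2)` is `2 / (w s + w t)`, the required mean. -/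

/-! ### Continuous distribution functions and their extremities -/

open Set in
/-- A continuous distribution function takes every value strictly between `0` and `1`. -/
theorem exists_cdf_eq (ν : Measure ℝ) [IsProbabilityMeasure ν] (hc : Continuous (cdf ν)) {u : ℝ}
    (h0 : 0 < u) (h1 : u < 1) : ∃ x, cdf ν x = u := by
  obtain ⟨a, ha⟩ := ((tendsto_cdf_atBot ν).eventually_lt_const h0).exists
  obtain ⟨b, hb⟩ := ((tendsto_cdf_atTop ν).eventually_const_lt h1).exists
  exact mem_range_of_exists_le_of_exists_ge hc ⟨a, ha.le⟩ ⟨b, hb.le⟩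

theorem lt_of_cdf_lt {ν : Measure ℝ} {x y : ℝ} (h : cdf ν x < cdf ν y) : x < y := by
  by_contra! h'
  exact absurd (monotone_cdf ν h') (not_le.2 h)

open Set in
/-- The probability integral transform: a continuous distribution function maps its law to the
uniform law. -/
theorem map_cdf_eq_volume_restrict (ν : Measure ℝ) [IsProbabilityMeasure ν]
    (hc : Continuous (cdf ν)) : ν.map (cdf ν) = volume.restrict (Ioo (0 : ℝ) 1) := by
  have : IsProbabilityMeasure (ν.map (cdf ν)) := Measure.isProbabilityMeasure_map hc.aemeasurable
  refine Measure.ext_of_Iic _ _ fun u => ?_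
  rw [Measure.map_apply hc.measurable measurableSet_Iic, Measure.restrict_apply measurableSet_Iic]
  rcases le_or_gt 1 u with hu | hu
  · have h1 : cdf ν ⁻¹' Iic u = univ := eq_univ_of_forall fun x => (cdf_le_one ν x).trans hu
    have h2 : Iic u ∩ Ioo (0 : ℝ) 1 = Ioo 0 1 :=
      inter_eq_right.2 fun x hx => hx.2.le.trans hu
    rw [h1, h2]
    simp
  · have h2 : Iic u ∩ Ioo (0 : ℝ) 1 = Ioc 0 u := by
      ext x
      simp only [mem_inter_iff, mem_Iic, mem_Ioo, mem_Ioc]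
      constructor
      · rintro ⟨h, h', -⟩; exact ⟨h', h⟩
      · rintro ⟨h, h'⟩; exact ⟨h', h, h'.trans_lt hu⟩
    rw [h2, Real.volume_Ioc, sub_zero]
    apply le_antisymm
    -- The sublevel set at `u` lies below any point where `cdf ν` equals some `w > u`. Letting `w`
    -- decrease to `max u 0` covers negative `u` as well.
    · have key : ∀ w : ℝ, max u 0 < w → w < 1 → ν (cdf ν ⁻¹' Iic u) ≤ ENNReal.ofReal w := by
        intro w hw hw1
        obtain ⟨x, hx⟩ := exists_cdf_eq ν hc ((le_max_right _ _).trans_lt hw) hw1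
        rw [← hx, ofReal_cdf]
        refine measure_mono fun y hy => le_of_lt (lt_of_cdf_lt (ν := ν) ?_)
        rw [hx]
        exact lt_of_le_of_lt hy ((le_max_left _ _).trans_lt hw)
      have hm : max u 0 < 1 := max_lt hu one_pos
      have ht : Tendsto (fun w : ℝ => ENNReal.ofReal w) (𝓝[>] (max u 0))
          (𝓝 (ENNReal.ofReal (max u 0))) :=
        (ENNReal.continuous_ofReal.tendsto _).mono_left nhdsWithin_le_nhds
      have := ge_of_tendsto ht (by
        filter_upwards [Ioo_mem_nhdsGT hm] with w hw using key w hw.1 hw.2)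
      simpa [ENNReal.ofReal_max] using this
    · rcases le_or_gt u 0 with h0 | h0
      · simp [ENNReal.ofReal_of_nonpos h0]
      · obtain ⟨x, hx⟩ := exists_cdf_eq ν hc h0 hu
        rw [← hx, ofReal_cdf]
        refine measure_mono fun y hy => ?_
        exact monotone_cdf ν hy

open Set in
theorem ae_cdf_mem_Ioo (ν : Measure ℝ) [IsProbabilityMeasure ν] (hc : Continuous (cdf ν)) :
    ∀ᵐ y ∂ν, cdf ν y ∈ Ioo (0 : ℝ) 1 := by
  have h : ∀ᵐ u ∂(ν.map (cdf ν)), u ∈ Ioo (0 : ℝ) 1 := by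
    rw [map_cdf_eq_volume_restrict ν hc]
    exact ae_restrict_mem measurableSet_Ioo
  exact ae_of_ae_map hc.aemeasurable h

theorem ae_cdf_ne (ν : Measure ℝ) [IsProbabilityMeasure ν] (hc : Continuous (cdf ν)) (c : ℝ) :
    ∀ᵐ y ∂ν, cdf ν y ≠ c := by
  have h : ∀ᵐ u ∂(ν.map (cdf ν)), u ≠ c := by
    rw [map_cdf_eq_volume_restrict ν hc]
    exact ae_restrict_of_ae (Measure.ae_ne _ c)
  exact ae_of_ae_map hc.aemeasurable h

-- This turns almost-everywhere statements into actual points at prescribed levels of the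
-- distribution function.
open Set in
theorem exists_cdf_mem_Ioo_of_ae (ν : Measure ℝ) [IsProbabilityMeasure ν]
    (hc : Continuous (cdf ν)) {p q : ℝ} (hpq : p < q) (hp : 0 ≤ p) (hq : q ≤ 1) {P : ℝ → Prop}
    (hP : ∀ᵐ y ∂ν, P y) : ∃ y, p < cdf ν y ∧ cdf ν y < q ∧ P y := by
  have h : ν (cdf ν ⁻¹' Ioo p q) ≠ 0 := by
    rw [← Measure.map_apply hc.measurable measurableSet_Ioo, map_cdf_eq_volume_restrict ν hc,
      Measure.restrict_apply measurableSet_Ioo,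
      inter_eq_left.2 (Ioo_subset_Ioo hp hq), Real.volume_Ioo]
    simpa using hpq
  obtain ⟨y, hy, hPy⟩ := ((frequently_ae_iff.2 h).and_eventually hP).exists
  exact ⟨y, hy.1, hy.2, hPy⟩

open Set in
theorem map_cdf_restrict_Ioo (ν : Measure ℝ) [IsProbabilityMeasure ν]
    (hc : Continuous (cdf ν)) (s t : ℝ) :
    (ν.restrict (Ioo s t)).map (cdf ν) = volume.restrict (Ioo (cdf ν s) (cdf ν t)) := by
  -- The two sets differ only where `cdf ν` is flat at the level of an end point, and level sets are
  -- null.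
  have h : (Ioo s t : Set ℝ) =ᵐ[ν] cdf ν ⁻¹' Ioo (cdf ν s) (cdf ν t) := by
    filter_upwards [ae_cdf_ne ν hc (cdf ν s), ae_cdf_ne ν hc (cdf ν t)] with y hs ht
    refine propext ⟨fun hy => ⟨?_, ?_⟩, fun hy => ⟨lt_of_cdf_lt hy.1, lt_of_cdf_lt hy.2⟩⟩
    · exact lt_of_le_of_ne (monotone_cdf ν hy.1.le) hs.symm
    · exact lt_of_le_of_ne (monotone_cdf ν hy.2.le) ht
  rw [Measure.restrict_congr_set h, ← Measure.restrict_map hc.measurable measurableSet_Ioo,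
    map_cdf_eq_volume_restrict ν hc, Measure.restrict_restrict measurableSet_Ioo,
    inter_eq_left.2 (Ioo_subset_Ioo (cdf_nonneg ν s) (cdf_le_one ν t))]

/-- By continuity neither condition on the right can hold at an extremity itself. From here on the
extended real end points are replaced by inequalities for `cdf ν`. -/
theorem openInterval_extremities_eq (ν : Measure ℝ) [IsProbabilityMeasure ν]
    (hc : Continuous (cdf ν)) :
    openInterval (leftExtremity fun y => cdf ν y) (rightExtremity fun y => cdf ν y) =
      {y | 0 < cdf ν y ∧ cdf ν y < 1} := by
  ext y
  simp only [openInterval, leftExtremity, rightExtremity, sInf_lt_iff, lt_sSup_iff,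
    Set.mem_image, Set.mem_ofPred_eq, exists_exists_and_eq_and, EReal.coe_lt_coe_iff]
  refine and_congr ⟨?_, fun h => ?_⟩ ⟨?_, fun h => ?_⟩
  · rintro ⟨z, hz, hzy⟩
    exact hz.trans_le (monotone_cdf ν hzy.le)
  · have : ∀ᶠ z in 𝓝[<] y, 0 < cdf ν z :=
      nhdsWithin_le_nhds (hc.continuousAt.eventually_const_lt h)
    obtain ⟨z, hz, hzy⟩ := (this.and self_mem_nhdsWithin).exists
    exact ⟨z, hz, hzy⟩
  · rintro ⟨z, hz, hzy⟩
    exact (monotone_cdf ν hzy.le).trans_lt hz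
  · have : ∀ᶠ z in 𝓝[>] y, cdf ν z < 1 :=
      nhdsWithin_le_nhds (hc.continuousAt.eventually_lt_const h)
    obtain ⟨z, hz, hzy⟩ := (this.and self_mem_nhdsWithin).exists
    exact ⟨z, hz, hzy⟩

/-- Near the left extremity the distribution function takes small positive values only. -/
theorem tendsto_cdf_rightLimitFilter (ν : Measure ℝ) [IsProbabilityMeasure ν]
    (hc : Continuous (cdf ν)) :
    Tendsto (cdf ν) (rightLimitFilter (leftExtremity fun y => cdf ν y)) (𝓝[>] 0) := by
  have key : ∀ z : ℝ, 0 < cdf ν z →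
      ∀ᶠ y in rightLimitFilter (leftExtremity fun y => cdf ν y), 0 < cdf ν y ∧ y < z := by
    intro z hz
    have h1 : (leftExtremity fun y => cdf ν y) ≤ (z : EReal) := sInf_le ⟨z, hz, rfl⟩
    -- A second point below `z` puts the extremity strictly below `z`, so that the interval between
    -- them is a right neighbourhood.
    obtain ⟨w, hw, hwz⟩ : ∃ w, 0 < cdf ν w ∧ w < z := by
      have : ∀ᶠ w in 𝓝[<] z, 0 < cdf ν w :=
        nhdsWithin_le_nhds (hc.continuousAt.eventually_const_lt hz)
      exact (this.and self_mem_nhdsWithin).exists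
    have h2 : (leftExtremity fun y => cdf ν y) < (z : EReal) :=
      (sInf_le ⟨w, hw, rfl⟩ : (leftExtremity fun y => cdf ν y) ≤ (w : EReal)).trans_lt
        (EReal.coe_lt_coe_iff.2 hwz)
    refine ⟨_, Ioo_mem_nhdsGT h2, fun y hy => ?_⟩
    have hy1 := hy.1
    simp only [leftExtremity, sInf_lt_iff, Set.mem_image, Set.mem_ofPred_eq,
      exists_exists_and_eq_and, EReal.coe_lt_coe_iff] at hy1
    obtain ⟨v, hv, hvy⟩ := hy1
    exact ⟨hv.trans_le (monotone_cdf ν hvy.le), EReal.coe_lt_coe_iff.1 hy.2⟩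
  refine tendsto_nhdsWithin_iff.2 ⟨?_, ?_⟩
  · refine tendsto_order.2 ⟨fun c hc' => ?_, fun c hc' => ?_⟩
    · exact Eventually.of_forall fun y => hc'.trans_le (cdf_nonneg ν y)
    · obtain ⟨z, hz⟩ := exists_cdf_eq ν hc (u := min c 1 / 2) (by positivity)
        (by linarith [min_le_right c 1])
      filter_upwards [key z (by rw [hz]; positivity)] with y hy
      calc cdf ν y ≤ cdf ν z := monotone_cdf ν hy.2.le
        _ < c := by rw [hz]; linarith [min_le_left c 1, lt_min hc' one_pos]
  · obtain ⟨z, hz⟩ := exists_cdf_eq ν hc (u := 1 / 2) (by norm_num) (by norm_num)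
    filter_upwards [key z (by rw [hz]; norm_num)] with y hy using hy.1

theorem rightLimitFilter_neBot {a : EReal} (ha : a ≠ ⊤) : (rightLimitFilter a).NeBot := by
  refine comap_neBot fun S hS => ?_
  obtain ⟨e, he, hS⟩ := (mem_nhdsGT_iff_exists_Ioo_subset' (lt_top_iff_ne_top.2 ha)).1 hS
  obtain ⟨y, h1, h2⟩ := EReal.lt_iff_exists_real_btwn.1 he
  exact ⟨y, hS (Set.mem_Ioo.2 ⟨h1, h2⟩)⟩

theorem leftExtremity_cdf_ne_top (ν : Measure ℝ) [IsProbabilityMeasure ν] :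
    (leftExtremity fun y => cdf ν y) ≠ ⊤ := by
  obtain ⟨z, hz⟩ := ((tendsto_cdf_atTop ν).eventually_const_lt one_pos).exists
  have h : (leftExtremity fun y => cdf ν y) ≤ (z : EReal) := sInf_le ⟨z, hz, rfl⟩
  exact (h.trans_lt (EReal.coe_lt_top z)).ne

/-! ### The hazard measure -/

/-- The hazard measure `dν / ν(v, ∞)` of a law on the line. -/
noncomputable def hazardMeasure (ν : Measure ℝ) : Measure ℝ :=
  ν.withDensity fun v => (ν (Set.Ioi v))⁻¹

theorem measure_Ioi_eq_ofReal (ν : Measure ℝ) [IsProbabilityMeasure ν] (v : ℝ) :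
    ν (Set.Ioi v) = ENNReal.ofReal (1 - cdf ν v) := by
  rw [← Set.compl_Iic, prob_compl_eq_one_sub measurableSet_Iic, ← ofReal_cdf,
    ENNReal.ofReal_sub _ (cdf_nonneg ν v), ENNReal.ofReal_one]

theorem measurable_inv_measure_Ioi (ν : Measure ℝ) [IsProbabilityMeasure ν] :
    Measurable fun v => (ν (Set.Ioi v))⁻¹ := by
  simp_rw [measure_Ioi_eq_ofReal]
  exact (measurable_const.sub (monotone_cdf ν).measurable).ennreal_ofReal.inv

instance (ν : Measure ℝ) [IsProbabilityMeasure ν] : SFinite (hazardMeasure ν) := by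
  unfold hazardMeasure; infer_instance

open Set in
theorem hazardMeasure_Ioo_lt_top (ν : Measure ℝ) [IsProbabilityMeasure ν] (s : ℝ) {t : ℝ}
    (ht : cdf ν t < 1) : hazardMeasure ν (Ioo s t) < ⊤ := by
  have h0 : ν (Ioi t) ≠ 0 := by
    rw [measure_Ioi_eq_ofReal]; simpa using ht
  rw [hazardMeasure, withDensity_apply _ measurableSet_Ioo]
  calc ∫⁻ v in Ioo s t, (ν (Ioi v))⁻¹ ∂ν ≤ ∫⁻ v in Ioo s t, (ν (Ioi t))⁻¹ ∂ν := by
        refine setLIntegral_mono measurable_const fun v hv => ?_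
        exact ENNReal.inv_le_inv.2 (measure_mono (Ioi_subset_Ioi hv.2.le))
    _ < ⊤ := by
        rw [setLIntegral_const]
        exact ENNReal.mul_lt_top (ENNReal.inv_lt_top.2 (pos_iff_ne_zero.2 h0))
          (measure_lt_top _ _)

open Set in
/-- Integrals against the hazard measure in terms of the probability integral transform. -/
theorem setIntegral_hazardMeasure_comp_cdf (ν : Measure ℝ) [IsProbabilityMeasure ν]
    (hc : Continuous (cdf ν)) {s t : ℝ} (ht : cdf ν t < 1) (φ : ℝ → ℝ)
    (hφ : ContinuousOn φ (Ioo (cdf ν s) (cdf ν t))) :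
    ∫ v in Ioo s t, φ (cdf ν v) ∂(hazardMeasure ν) =
      ∫ u in Ioo (cdf ν s) (cdf ν t), (1 - u)⁻¹ * φ u := by
  have hm : AEStronglyMeasurable (fun u => (1 - u)⁻¹ * φ u)
      (volume.restrict (Ioo (cdf ν s) (cdf ν t))) := by
    refine ContinuousOn.aestronglyMeasurable (ContinuousOn.mul ?_ hφ) measurableSet_Ioo
    refine ContinuousOn.inv₀ (by fun_prop) fun u hu => ?_
    have := hu.2
    linarith
  rw [← map_cdf_restrict_Ioo ν hc] at hm ⊢
  rw [integral_map hc.aemeasurable hm, hazardMeasure,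
    setIntegral_withDensity_eq_setIntegral_toReal_smul (measurable_inv_measure_Ioi ν) ?_ _
      measurableSet_Ioo]
  · refine setIntegral_congr_fun measurableSet_Ioo fun v hv => ?_
    have : cdf ν v < 1 := (monotone_cdf ν hv.2.le).trans_lt ht
    simp only [measure_Ioi_eq_ofReal, ENNReal.toReal_inv, smul_eq_mul]
    rw [ENNReal.toReal_ofReal (by linarith)]
  · refine ae_restrict_of_forall_mem measurableSet_Ioo fun v hv => ?_
    have : cdf ν v < 1 := (monotone_cdf ν hv.2.le).trans_lt ht
    rw [measure_Ioi_eq_ofReal]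
    simpa using this

-- In the variable `u = cdf ν v` the hazard measure is `du / (1 - u)`, with primitive `-log (1 -
-- u)`.
open Set in
theorem hazardMeasure_real_Ioo (ν : Measure ℝ) [IsProbabilityMeasure ν]
    (hc : Continuous (cdf ν)) {s t : ℝ} (hst : s ≤ t) (ht : cdf ν t < 1) :
    (hazardMeasure ν).real (Ioo s t) = Real.log (1 - cdf ν s) - Real.log (1 - cdf ν t) := by
  have h := setIntegral_hazardMeasure_comp_cdf ν hc (s := s) ht (fun _ => 1) continuousOn_const
  rw [setIntegral_const, smul_eq_mul, mul_one] at h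
  have hle := monotone_cdf ν hst
  rw [h, ← integral_Ioc_eq_integral_Ioo, ← intervalIntegral.integral_of_le hle]
  have hd : ∀ u ∈ uIcc (cdf ν s) (cdf ν t),
      HasDerivAt (fun u => -Real.log (1 - u)) ((1 - u)⁻¹ * 1) u := by
    intro u hu
    rw [uIcc_of_le hle] at hu
    have hu1 : 1 - u ≠ 0 := by have := hu.2; linarith
    convert! (((hasDerivAt_id u).const_sub 1).log hu1).neg using 1
    simp [neg_div]
  rw [intervalIntegral.integral_eq_sub_of_hasDerivAt hd]
  · ring
  · refine ContinuousOn.intervalIntegrable fun u hu => ContinuousAt.continuousWithinAt ?_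
    rw [uIcc_of_le hle] at hu
    have hu1 : 1 - u ≠ 0 := by have := hu.2; linarith
    exact ((continuousAt_const.sub continuousAt_id).inv₀ hu1).mul continuousAt_const

/-! ### Records as iterates of a first-exceedance map -/

/-- The first index at which the sequence `x` exceeds the level `z`. -/
noncomputable def exceedanceTime (z : ℝ) (x : ℕ → ℝ) : ℕ := sInf {j | z < x j}

/-- From a current record and the observations after it to the next record and the observations
after that one. -/
noncomputable def recordStep (p : ℝ × (ℕ → ℝ)) : ℝ × (ℕ → ℝ) :=
  (p.2 (exceedanceTime p.1 p.2), fun j => p.2 (exceedanceTime p.1 p.2 + 1 + j))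

/-- The record with number `m` (counted from `0`) and the observations after it. -/
noncomputable def recordState (m : ℕ) (x : ℕ → ℝ) : ℝ × (ℕ → ℝ) :=
  recordStep^[m] (x 0, fun j => x (j + 1))

theorem exceedanceTime_eq_zero {z : ℝ} {x : ℕ → ℝ} (h : z < x 0) : exceedanceTime z x = 0 :=
  Nat.sInf_eq_zero.2 (Or.inl h)

theorem exceedanceTime_eq_succ {z : ℝ} {x : ℕ → ℝ} (h0 : ¬ z < x 0) (h : ∃ j, z < x j) :
    exceedanceTime z x = exceedanceTime z (fun j => x (j + 1)) + 1 := by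
  have hne : {j | z < x (j + 1)}.Nonempty := by
    obtain ⟨_ | j, hj⟩ := h
    · exact absurd hj h0
    · exact ⟨j, hj⟩
  refine IsLeast.csInf_eq ⟨?_, ?_⟩
  · exact Nat.sInf_mem hne
  · rintro (_ | j) hj
    · exact absurd hj h0
    · exact Nat.succ_le_succ (Nat.sInf_le hj)

theorem recordStep_of_lt {z : ℝ} {x : ℕ → ℝ} (h : z < x 0) :
    recordStep (z, x) = (x 0, fun j => x (j + 1)) := by
  simp [recordStep, exceedanceTime_eq_zero h, add_comm]

theorem recordStep_of_not_lt {z : ℝ} {x : ℕ → ℝ} (h0 : ¬ z < x 0) (h : ∃ j, z < x j) :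
    recordStep (z, x) = recordStep (z, fun j => x (j + 1)) := by
  simp only [recordStep, exceedanceTime_eq_succ h0 h, Prod.mk.injEq, true_and]
  funext j
  congr 1
  ring

theorem recordState_zero (x : ℕ → ℝ) : recordState 0 x = (x 0, fun j => x (j + 1)) := rfl

theorem recordState_succ (m : ℕ) (x : ℕ → ℝ) :
    recordState (m + 1) x = recordStep (recordState m x) :=
  Function.iterate_succ_apply' _ _ _

/-- The hypothesis is essential: if no later observation exceeds the record, both definitions fall
back on `sInf ∅ = 0`, which is an absolute index in one and a relative one in the other. -/
theorem recordState_eq {x : ℕ → ℝ}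
    (h : ∀ m, ∃ j, (recordState m x).1 < (recordState m x).2 j) (m : ℕ) :
    recordState m x = (x (recordTime x m), fun j => x (recordTime x m + 1 + j)) := by
  induction m with
  | zero => simp [recordState_zero, recordTime, add_comm]
  | succ m ih =>
    have hm := h m
    rw [recordState_succ, ih]
    rw [ih] at hm
    have hL : recordTime x (m + 1) = recordTime x m + 1 +
        exceedanceTime (x (recordTime x m)) (fun j => x (recordTime x m + 1 + j)) := by
      rw [recordTime]
      refine IsLeast.csInf_eq ⟨⟨by omega, ?_⟩, ?_⟩
      · exact Nat.sInf_mem (s := {j | x (recordTime x m) < x (recordTime x m + 1 + j)}) hm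
      · rintro k ⟨hk, hxk⟩
        obtain ⟨j, rfl⟩ : ∃ j, k = recordTime x m + 1 + j := ⟨k - (recordTime x m + 1), by omega⟩
        exact Nat.add_le_add_left (Nat.sInf_le hxk) _
    simp only [recordStep, hL, add_assoc]

theorem measurable_exceedanceTime :
    Measurable fun p : ℝ × (ℕ → ℝ) => exceedanceTime p.1 p.2 := by
  refine measurable_to_countable' fun k => ?_
  have hS : ∀ j, MeasurableSet {p : ℝ × (ℕ → ℝ) | p.1 < p.2 j} := fun j =>
    measurableSet_lt measurable_fst ((measurable_pi_apply j).comp measurable_snd)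
  -- The second set of the union is the default value `sInf ∅ = 0`, taken when the level is never
  -- exceeded.
  have : (fun p : ℝ × (ℕ → ℝ) => exceedanceTime p.1 p.2) ⁻¹' {k} =
      ({p | p.1 < p.2 k} ∩ ⋂ j ∈ Set.Iio k, {p : ℝ × (ℕ → ℝ) | p.1 < p.2 j}ᶜ) ∪
        ({_p | k = 0} ∩ ⋂ j, {p : ℝ × (ℕ → ℝ) | p.1 < p.2 j}ᶜ) := by
    ext p
    simp only [Set.mem_preimage, Set.mem_singleton_iff, Set.mem_union, Set.mem_inter_iff,
      Set.mem_ofPred_eq, Set.mem_iInter, Set.mem_compl_iff, Set.mem_Iio]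
    by_cases hne : ∃ j, p.1 < p.2 j
    · have h1 : p.1 < p.2 (exceedanceTime p.1 p.2) :=
        Nat.sInf_mem (s := {j | p.1 < p.2 j}) hne
      constructor
      · rintro rfl
        exact Or.inl ⟨h1, fun j hj => Nat.notMem_of_lt_sInf hj⟩
      · rintro (⟨hk, hj⟩ | ⟨-, hj⟩)
        · exact IsLeast.csInf_eq ⟨hk, fun j hj' => not_lt.1 fun hlt => hj j hlt hj'⟩
        · exact absurd hne (by simpa using hj)
    · have h0 : exceedanceTime p.1 p.2 = 0 :=
        Nat.sInf_eq_zero.2 (Or.inr (Set.eq_empty_of_forall_notMem fun j hj => hne ⟨j, hj⟩))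
      push Not at hne
      rw [h0]
      constructor
      · rintro rfl
        exact Or.inr ⟨rfl, fun j => not_lt.2 (hne j)⟩
      · rintro (⟨hk, -⟩ | ⟨hk, -⟩)
        · exact absurd hk (not_lt.2 (hne k))
        · exact hk.symm
  rw [this]
  refine ((hS k).inter (MeasurableSet.biInter (Set.to_countable _) fun j _ => (hS j).compl)).union
    ((MeasurableSet.const _).inter (MeasurableSet.iInter fun j => (hS j).compl))

theorem measurable_recordStep : Measurable recordStep := by
  have he : Measurable fun q : (ℕ → ℝ) × ℕ => q.1 q.2 :=
    measurable_from_prod_countable_left fun n => measurable_pi_apply n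
  refine Measurable.prodMk (he.comp (measurable_snd.prodMk measurable_exceedanceTime)) ?_
  refine measurable_pi_lambda _ fun j => ?_
  exact he.comp (measurable_snd.prodMk ((measurable_exceedanceTime.add_const 1).add_const j))

theorem measurable_head_tail :
    Measurable fun x : ℕ → ℝ => ((x 0, fun j => x (j + 1)) : ℝ × (ℕ → ℝ)) := by fun_prop

theorem measurable_recordState (m : ℕ) : Measurable (recordState m) :=
  (measurable_recordStep.iterate m).comp measurable_head_tail

/-! ### The i.i.d. law and the strong Markov property -/

/-- The law of an i.i.d. sequence with common law `ν`. -/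
noncomputable abbrev iidLaw (ν : Measure ℝ) [IsProbabilityMeasure ν] : Measure (ℕ → ℝ) :=
  Measure.infinitePi fun _ : ℕ => ν

theorem map_head_tail_iidLaw (ν : Measure ℝ) [IsProbabilityMeasure ν] :
    (iidLaw ν).map (fun x => ((x 0, fun j => x (j + 1)) : ℝ × (ℕ → ℝ))) =
      ν.prod (iidLaw ν) := by
  let cons : ℝ × (ℕ → ℝ) → ℕ → ℝ := fun q i => Nat.casesOn i q.1 q.2
  have hcons : Measurable cons := by
    refine measurable_pi_lambda _ fun i => ?_
    cases i with
    | zero => exact measurable_fst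
    | succ i => exact (measurable_pi_apply i).comp measurable_snd
  have hmap : (ν.prod (iidLaw ν)).map cons = iidLaw ν := by
    refine Measure.eq_infinitePi _ fun s t ht => ?_
    classical
    obtain ⟨n, hn⟩ : ∃ n, s ⊆ Finset.range (n + 1) :=
      ⟨s.sup id, fun i hi => Finset.mem_range_succ_iff.2 (Finset.le_sup (f := id) hi)⟩
    -- Padding with `univ` replaces the finite index set by an initial segment, from which
    -- coordinate `0` splits off.
    let t' : ℕ → Set ℝ := fun i => if i ∈ s then t i else Set.univ
    have ht' : ∀ i, MeasurableSet (t' i) := fun i => by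
      by_cases hi : i ∈ s <;> simp [t', hi, ht i]
    have hpre : cons ⁻¹' (Set.pi s t) =
        t' 0 ×ˢ Set.pi (Finset.range n) (fun i => t' (i + 1)) := by
      ext q
      simp only [Set.mem_preimage, Set.mem_pi, Set.mem_prod, Finset.coe_range, Set.mem_Iio,
        Finset.mem_coe]
      constructor
      · intro h
        refine ⟨?_, fun i _ => ?_⟩
        · by_cases hi : 0 ∈ s
          · simp only [t', if_pos hi]; exact h 0 hi
          · simp [t', hi]
        · by_cases hi : i + 1 ∈ s
          · simpa [t', hi] using h (i + 1) hi
          · simp [t', hi]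
      · rintro ⟨h0, h⟩ (_ | i) hi
        · simp only [t', if_pos hi] at h0; exact h0
        · simpa [t', hi] using h i (by simpa using hn hi)
    rw [Measure.map_apply hcons (MeasurableSet.pi s.countable_toSet fun i _ => ht i), hpre,
      Measure.prod_prod, Measure.infinitePi_pi _ fun i _ => ht' (i + 1), mul_comm,
      ← Finset.prod_range_succ' (fun i => ν (t' i))]
    rw [← Finset.prod_subset hn fun i _ hi => by simp [t', hi]]
    exact Finset.prod_congr rfl fun i hi => by simp [t', hi]
  conv_lhs => rw [← hmap]
  rw [Measure.map_map measurable_head_tail hcons]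
  exact Measure.map_id

/-- Almost surely an i.i.d. sequence exceeds a level that is exceeded with positive probability. -/
theorem ae_exists_lt_iidLaw (ν : Measure ℝ) [IsProbabilityMeasure ν] {z : ℝ}
    (hz : ν (Set.Ioi z) ≠ 0) : ∀ᵐ x ∂(iidLaw ν), ∃ j, z < x j := by
  set J : Set (ℕ → ℝ) := {x | ¬ ∃ j, z < x j}
  have hJm : MeasurableSet J := by
    have : J = ⋂ j, {x : ℕ → ℝ | x j ≤ z} := by ext x; simp [J]
    rw [this]
    exact MeasurableSet.iInter fun j => measurableSet_le (measurable_pi_apply j) measurable_const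
  -- Never exceeding `z` means that `x 0` does not and that the tail never does; since the factor is
  -- less than `1`, the probability vanishes.
  have hrec : iidLaw ν J = ν (Set.Iic z) * iidLaw ν J := by
    have hpre : J = (fun x : ℕ → ℝ => ((x 0, fun j => x (j + 1)) : ℝ × (ℕ → ℝ))) ⁻¹'
        (Set.Iic z ×ˢ J) := by
      ext x
      simp only [J, Set.mem_ofPred_eq, not_exists, not_lt, Set.mem_preimage, Set.mem_prod,
        Set.mem_Iic]
      exact ⟨fun h => ⟨h 0, fun j => h (j + 1)⟩, fun h j => by
        cases j with
        | zero => exact h.1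
        | succ j => exact h.2 j⟩
    conv_lhs => rw [hpre, ← Measure.map_apply measurable_head_tail
      (measurableSet_Iic.prod hJm), map_head_tail_iidLaw, Measure.prod_prod]
  have hlt : ν (Set.Iic z) < 1 := by
    rw [← Set.compl_Ioi, prob_compl_eq_one_sub measurableSet_Ioi]
    exact ENNReal.sub_lt_self ENNReal.one_ne_top one_ne_zero hz
  change iidLaw ν J = 0
  by_contra h0
  have := ENNReal.mul_lt_mul_left h0 (measure_ne_top (iidLaw ν) J) hlt
  rw [one_mul, ← hrec] at this
  exact lt_irrefl _ this

/-- The strong Markov property at the first exceedance of a level: the exceeding value has the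
conditional law given the exceedance, and is independent of the observations after it. -/
theorem map_recordStep_iidLaw (ν : Measure ℝ) [IsProbabilityMeasure ν] {z : ℝ}
    (hz : ν (Set.Ioi z) ≠ 0) :
    (iidLaw ν).map (fun x => recordStep (z, x)) =
      (ν (Set.Ioi z))⁻¹ • (ν.restrict (Set.Ioi z)).prod (iidLaw ν) := by
  have hm : Measurable fun x : ℕ → ℝ => recordStep (z, x) :=
    measurable_recordStep.comp measurable_prodMk_left
  ext S hS
  rw [Measure.map_apply hm hS, Measure.smul_apply, smul_eq_mul]
  set B : Set (ℕ → ℝ) := (fun x => recordStep (z, x)) ⁻¹' S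
  have hBm : MeasurableSet B := hm hS
  have hIm : MeasurableSet ((Set.Ioi z ×ˢ Set.univ) ∩ S : Set (ℝ × (ℕ → ℝ))) :=
    (measurableSet_Ioi.prod MeasurableSet.univ).inter hS
  -- First-step analysis: either `x 0` exceeds `z`, or the search restarts on the tail. The
  -- resulting linear equation is solved for the probability of `B`.
  have hrec : iidLaw ν B =
      (ν.restrict (Set.Ioi z)).prod (iidLaw ν) S + ν (Set.Iic z) * iidLaw ν B := by
    have hae : B =ᵐ[iidLaw ν] (fun x : ℕ → ℝ => ((x 0, fun j => x (j + 1)) : ℝ × (ℕ → ℝ))) ⁻¹'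
        (((Set.Ioi z ×ˢ Set.univ) ∩ S) ∪ Set.Iic z ×ˢ B) := by
      filter_upwards [ae_exists_lt_iidLaw ν hz] with x hx
      refine propext ?_
      change recordStep (z, x) ∈ S ↔ ((z < x 0 ∧ True) ∧ (x 0, fun j => x (j + 1)) ∈ S) ∨
        (x 0 ≤ z ∧ recordStep (z, fun j => x (j + 1)) ∈ S)
      by_cases h0 : z < x 0
      · rw [recordStep_of_lt h0]
        simp [h0]
      · rw [recordStep_of_not_lt h0 hx]
        simp [h0, not_lt.1 h0]
    have hdisj : Disjoint ((Set.Ioi z ×ˢ Set.univ) ∩ S) (Set.Iic z ×ˢ B) := by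
      rw [Set.disjoint_left]
      rintro q ⟨⟨h1, -⟩, -⟩ ⟨h2, -⟩
      exact (Set.mem_Iic.1 h2).not_gt (Set.mem_Ioi.1 h1)
    conv_lhs => rw [measure_congr hae, ← Measure.map_apply measurable_head_tail
      (hIm.union (measurableSet_Iic.prod hBm)), map_head_tail_iidLaw,
      measure_union hdisj (measurableSet_Iic.prod hBm), Measure.prod_prod, Set.inter_comm,
      ← Measure.restrict_apply hS, ← Measure.prod_restrict, Measure.restrict_univ]
  have hone : ν (Set.Ioi z) + ν (Set.Iic z) = 1 := by
    rw [← Set.compl_Ioi, prob_add_prob_compl measurableSet_Ioi]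
  have hadd : ν (Set.Ioi z) * iidLaw ν B + ν (Set.Iic z) * iidLaw ν B =
      (ν.restrict (Set.Ioi z)).prod (iidLaw ν) S + ν (Set.Iic z) * iidLaw ν B := by
    rw [← add_mul, hone, one_mul, ← hrec]
  have hfin : ν (Set.Iic z) * iidLaw ν B ≠ ⊤ :=
    ENNReal.mul_ne_top (measure_ne_top _ _) (measure_ne_top _ _)
  rw [← (ENNReal.add_left_inj hfin).1 hadd, ← mul_assoc,
    ENNReal.inv_mul_cancel hz (measure_ne_top _ _), one_mul]

/-! ### Laws of single records and of three consecutive ones -/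

/-- The law of the record with number `m`, counted from `0`. -/
noncomputable def recordLaw (ν : Measure ℝ) [IsProbabilityMeasure ν] (m : ℕ) : Measure ℝ :=
  (iidLaw ν).map fun x => (recordState m x).1

instance (ν : Measure ℝ) [IsProbabilityMeasure ν] (m : ℕ) : IsProbabilityMeasure (recordLaw ν m) :=
  Measure.isProbabilityMeasure_map (measurable_recordState m).fst.aemeasurable

theorem recordLaw_zero (ν : Measure ℝ) [IsProbabilityMeasure ν] : recordLaw ν 0 = ν := by
  have : (fun x : ℕ → ℝ => (recordState 0 x).1) = fun x => x 0 := rfl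
  rw [recordLaw, this]
  exact Measure.infinitePi_map_eval _ 0

theorem ae_measure_Ioi_ne_zero (ν : Measure ℝ) [IsProbabilityMeasure ν]
    (hc : Continuous (cdf ν)) : ∀ᵐ z ∂ν, ν (Set.Ioi z) ≠ 0 := by
  filter_upwards [ae_cdf_mem_Ioo ν hc] with z hz
  rw [measure_Ioi_eq_ofReal]
  simpa using hz.2

/-- The strong Markov property integrated over a starting level with law `ρ`, independent of the
observations. -/
theorem lintegral_recordStep (ν ρ : Measure ℝ) [IsProbabilityMeasure ν] [SFinite ρ]
    (hρ : ∀ᵐ z ∂ρ, ν (Set.Ioi z) ≠ 0) {F : ℝ → ℝ × (ℕ → ℝ) → ENNReal}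
    (hF : Measurable (Function.uncurry F)) :
    ∫⁻ p, F p.1 (recordStep p) ∂(ρ.prod (iidLaw ν)) =
      ∫⁻ z, (ν (Set.Ioi z))⁻¹ * ∫⁻ v in Set.Ioi z, ∫⁻ x, F z (v, x) ∂(iidLaw ν) ∂ν ∂ρ := by
  have hFm : Measurable fun p : ℝ × (ℕ → ℝ) => F p.1 (recordStep p) :=
    hF.comp (measurable_fst.prodMk measurable_recordStep)
  rw [lintegral_prod _ hFm.aemeasurable]
  refine lintegral_congr_ae ?_
  filter_upwards [hρ] with z hz
  have hm : Measurable fun x : ℕ → ℝ => recordStep (z, x) :=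
    measurable_recordStep.comp measurable_prodMk_left
  have hFz : Measurable (F z) := hF.comp measurable_prodMk_left
  rw [← lintegral_map (g := fun x => recordStep (z, x)) hFz hm, map_recordStep_iidLaw ν hz,
    lintegral_smul_measure, lintegral_prod _ hFz.aemeasurable, smul_eq_mul]

/-- The current record is independent of the later observations; its law is equivalent to the
common law of the observations. -/
theorem map_recordState_and_recordLaw (ν : Measure ℝ) [IsProbabilityMeasure ν]
    (hc : Continuous (cdf ν)) (m : ℕ) :
    (iidLaw ν).map (recordState m) = (recordLaw ν m).prod (iidLaw ν) ∧
      recordLaw ν m ≪ ν ∧ ν ≪ recordLaw ν m := by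
  induction m with
  | zero =>
    rw [recordLaw_zero]
    exact ⟨map_head_tail_iidLaw ν, Measure.AbsolutelyContinuous.rfl,
      Measure.AbsolutelyContinuous.rfl⟩
  | succ m ih =>
    obtain ⟨hmap, hac, hca⟩ := ih
    have hne : ∀ᵐ z ∂(recordLaw ν m), ν (Set.Ioi z) ≠ 0 := hac (ae_measure_Ioi_ne_zero ν hc)
    have hmeas : ∀ A, MeasurableSet A → Measurable fun z => (ν (Set.Ioi z))⁻¹ * ν (A ∩ Set.Ioi z) := by
      intro A hA
      refine (measurable_inv_measure_Ioi ν).mul ?_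
      have : MeasurableSet {p : ℝ × ℝ | p.2 ∈ A ∧ p.1 < p.2} :=
        (measurable_snd hA).inter (measurableSet_lt measurable_fst measurable_snd)
      exact measurable_measure_prodMk_left this
    have hrect : ∀ (A : Set ℝ) (B : Set (ℕ → ℝ)), MeasurableSet A → MeasurableSet B →
        (iidLaw ν).map (recordState (m + 1)) (A ×ˢ B) =
          (∫⁻ z, (ν (Set.Ioi z))⁻¹ * ν (A ∩ Set.Ioi z) ∂(recordLaw ν m)) * iidLaw ν B := by
      intro A B hA hB
      have hfun : recordState (m + 1) = fun x => recordStep (recordState m x) :=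
        funext (recordState_succ m)
      have hF : Measurable (Function.uncurry fun (_ : ℝ) (q : ℝ × (ℕ → ℝ)) =>
          (A ×ˢ B).indicator (1 : ℝ × (ℕ → ℝ) → ENNReal) q) :=
        (measurable_one.indicator (hA.prod hB)).comp measurable_snd
      have h := lintegral_recordStep ν (recordLaw ν m) hne hF
      have hAB := measurable_recordStep (hA.prod hB)
      rw [hfun, ← Function.comp_def, ← Measure.map_map measurable_recordStep
        (measurable_recordState m), hmap, Measure.map_apply measurable_recordStep (hA.prod hB),
        ← lintegral_indicator_one hAB]
      refine h.trans ?_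
      rw [← lintegral_mul_const _ (hmeas A hA)]
      refine lintegral_congr fun z => ?_
      rw [mul_assoc]
      congr 1
      have : ∀ v, ∫⁻ x, (A ×ˢ B).indicator (1 : ℝ × (ℕ → ℝ) → ENNReal) (v, x) ∂(iidLaw ν) =
          A.indicator (fun _ => iidLaw ν B) v := by
        intro v
        by_cases hv : v ∈ A
        · rw [Set.indicator_of_mem hv, ← lintegral_indicator_one hB]
          refine lintegral_congr fun x => ?_
          have hiff : (v, x) ∈ A ×ˢ B ↔ x ∈ B := ⟨fun h => h.2, fun h => ⟨hv, h⟩⟩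
          by_cases hx : x ∈ B
          · rw [Set.indicator_of_mem (hiff.2 hx), Set.indicator_of_mem hx]; rfl
          · rw [Set.indicator_of_notMem (mt hiff.1 hx), Set.indicator_of_notMem hx]
        · simp [Set.indicator, hv]
      simp_rw [this]
      rw [lintegral_indicator hA, lintegral_const, Measure.restrict_apply_univ,
        Measure.restrict_apply hA, mul_comm]
    have hlaw : ∀ A, MeasurableSet A → recordLaw ν (m + 1) A =
        ∫⁻ z, (ν (Set.Ioi z))⁻¹ * ν (A ∩ Set.Ioi z) ∂(recordLaw ν m) := by
      intro A hA
      have h := hrect A Set.univ hA MeasurableSet.univ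
      rw [measure_univ, mul_one, Measure.map_apply (measurable_recordState _)
        (hA.prod MeasurableSet.univ)] at h
      rw [← h, recordLaw, Measure.map_apply (measurable_recordState _).fst hA]
      congr 1
      ext x
      simp
    refine ⟨(Measure.prod_eq fun A B hA hB => ?_).symm, ?_, ?_⟩
    · rw [hrect A B hA hB, hlaw A hA]
    · refine Measure.AbsolutelyContinuous.mk fun A hA h0 => ?_
      rw [hlaw A hA]
      refine (lintegral_congr fun z => ?_).trans lintegral_zero
      rw [measure_mono_null Set.inter_subset_left h0, mul_zero]
    · refine Measure.AbsolutelyContinuous.mk fun A hA h0 => ?_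
      rw [hlaw A hA, lintegral_eq_zero_iff (hmeas A hA)] at h0
      -- Levels `z` with arbitrarily small `cdf ν z` then give `ν A = 0`.
      have hA0 : ∀ᵐ z ∂ν, ν (A ∩ Set.Ioi z) = 0 := by
        refine hca ?_
        filter_upwards [h0] with z hz
        simpa [measure_ne_top] using hz
      have hle : ∀ ε : ℝ, 0 < ε → ε < 1 → ν A ≤ ENNReal.ofReal ε := by
        intro ε hε hε1
        obtain ⟨z, -, hzε, hz⟩ := exists_cdf_mem_Ioo_of_ae ν hc hε le_rfl hε1.le hA0
        calc ν A ≤ ν (Set.Iic z ∪ A ∩ Set.Ioi z) := measure_mono fun y hy =>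
              (le_or_gt y z).imp id fun h => ⟨hy, h⟩
          _ ≤ ν (Set.Iic z) + ν (A ∩ Set.Ioi z) := measure_union_le _ _
          _ ≤ ENNReal.ofReal ε := by
            rw [hz, add_zero, ← ofReal_cdf]
            exact ENNReal.ofReal_le_ofReal hzε.le
      have ht : Tendsto (fun ε : ℝ => ENNReal.ofReal ε) (𝓝[>] 0) (𝓝 (ENNReal.ofReal 0)) :=
        (ENNReal.continuous_ofReal.tendsto _).mono_left nhdsWithin_le_nhds
      have := ge_of_tendsto ht (by
        filter_upwards [Ioo_mem_nhdsGT one_pos] with ε hε using hle ε hε.1 hε.2)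
      simpa using this

/-- Each record is almost surely a level of positive exceedance probability, and the later
observations are a fresh i.i.d. sequence; so a next record exists. -/
theorem ae_recordState_eq (ν : Measure ℝ) [IsProbabilityMeasure ν] (hc : Continuous (cdf ν)) :
    ∀ᵐ x ∂(iidLaw ν), ∀ m, (recordState m x).1 = x (recordTime x m) := by
  have h : ∀ᵐ x ∂(iidLaw ν), ∀ m, ∃ j, (recordState m x).1 < (recordState m x).2 j := by
    refine ae_all_iff.2 fun m => ?_
    obtain ⟨hmap, hac, -⟩ := map_recordState_and_recordLaw ν hc m
    have hS : MeasurableSet {p : ℝ × (ℕ → ℝ) | ∃ j, p.1 < p.2 j} := by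
      rw [Set.ofPred_exists]
      exact MeasurableSet.iUnion fun j =>
        measurableSet_lt measurable_fst ((measurable_pi_apply j).comp measurable_snd)
    refine ae_of_ae_map (p := fun q : ℝ × (ℕ → ℝ) => ∃ j, q.1 < q.2 j)
      (measurable_recordState m).aemeasurable ?_
    rw [hmap, Measure.ae_prod_iff_ae_ae hS]
    filter_upwards [hac (ae_measure_Ioi_ne_zero ν hc)] with z hz using ae_exists_lt_iidLaw ν hz
  filter_upwards [h] with x hx m
  rw [recordState_eq hx]

/-- Two Markov steps contribute `1 / ν(s, ∞)` and `1 / ν(v, ∞)` on `s < v < t`. The second factor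
turns `dν(v)` into the hazard measure, and Tonelli moves `v` innermost. -/
theorem lintegral_record_triple (ν : Measure ℝ) [IsProbabilityMeasure ν]
    (hc : Continuous (cdf ν)) (m : ℕ) {F : (ℝ × ℝ) × ℝ → ENNReal} (hF : Measurable F) :
    ∫⁻ x, F (((recordState m x).1, (recordState (m + 2) x).1), (recordState (m + 1) x).1)
        ∂(iidLaw ν) =
      ∫⁻ s, ∫⁻ t, (ν (Set.Ioi s))⁻¹ * ∫⁻ v in Set.Ioo s t, F ((s, t), v) ∂(hazardMeasure ν)
        ∂ν ∂(recordLaw ν m) := by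
  obtain ⟨hmap, hac, -⟩ := map_recordState_and_recordLaw ν hc m
  have hne := ae_measure_Ioi_ne_zero ν hc
  have hF1 : Measurable (Function.uncurry fun (z : ℝ) (q : ℝ × (ℕ → ℝ)) =>
      F ((z, (recordStep q).1), q.1)) :=
    hF.comp ((measurable_fst.prodMk (measurable_recordStep.comp measurable_snd).fst).prodMk
      measurable_snd.fst)
  have hF2 : ∀ z, Measurable (Function.uncurry fun (v : ℝ) (q : ℝ × (ℕ → ℝ)) =>
      F ((z, q.1), v)) := fun z =>
    hF.comp ((measurable_const.prodMk measurable_snd.fst).prodMk measurable_fst)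
  have hFp : Measurable fun p : ℝ × (ℕ → ℝ) =>
      F ((p.1, (recordStep (recordStep p)).1), (recordStep p).1) :=
    hF1.comp (measurable_fst.prodMk measurable_recordStep)
  have h1 : ∫⁻ x, F (((recordState m x).1, (recordState (m + 2) x).1), (recordState (m + 1) x).1)
      ∂(iidLaw ν) = ∫⁻ p, F ((p.1, (recordStep (recordStep p)).1), (recordStep p).1)
        ∂((recordLaw ν m).prod (iidLaw ν)) := by
    rw [← hmap, lintegral_map hFp (measurable_recordState m)]
    simp only [recordState_succ]
  rw [h1, lintegral_recordStep ν (recordLaw ν m) (hac hne) hF1]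
  refine lintegral_congr fun z => ?_
  have hsec : ∀ t, Measurable fun v => F ((z, t), v) := fun t =>
    hF.comp measurable_prodMk_left
  have hvt : Measurable fun p : ℝ × ℝ => F ((z, p.2), p.1) :=
    hF.comp ((measurable_const.prodMk measurable_snd).prodMk measurable_fst)
  have hT : MeasurableSet {p : ℝ × ℝ | z < p.1 ∧ p.1 < p.2} :=
    (measurableSet_lt measurable_const measurable_fst).inter
      (measurableSet_lt measurable_fst measurable_snd)
  have hind : Measurable ({p : ℝ × ℝ | z < p.1 ∧ p.1 < p.2}.indicator
      fun p : ℝ × ℝ => F ((z, p.2), p.1)) := hvt.indicator hT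
  have hpr : Measurable fun p : ℝ × (ℕ → ℝ) => F ((z, (recordStep p).1), p.1) :=
    hF1.comp measurable_prodMk_left
  have hsw : ∀ t v, (Set.Ioo z t).indicator (fun v => F ((z, t), v)) v =
      {p : ℝ × ℝ | z < p.1 ∧ p.1 < p.2}.indicator (fun p : ℝ × ℝ => F ((z, p.2), p.1)) (v, t) := by
    intro t v
    simp [Set.indicator]
  have h2 : ∫⁻ v in Set.Ioi z, ∫⁻ x, F ((z, (recordStep (v, x)).1), v) ∂(iidLaw ν) ∂ν =
      ∫⁻ t, ∫⁻ v in Set.Ioo z t, F ((z, t), v) ∂(hazardMeasure ν) ∂ν := by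
    calc ∫⁻ v in Set.Ioi z, ∫⁻ x, F ((z, (recordStep (v, x)).1), v) ∂(iidLaw ν) ∂ν
        = ∫⁻ p, F ((z, (recordStep p).1), p.1) ∂((ν.restrict (Set.Ioi z)).prod (iidLaw ν)) :=
          (lintegral_prod _ hpr.aemeasurable).symm
      _ = ∫⁻ v in Set.Ioi z, (ν (Set.Ioi v))⁻¹ * ∫⁻ t in Set.Ioi v, F ((z, t), v) ∂ν ∂ν := by
          refine (lintegral_recordStep ν (ν.restrict (Set.Ioi z)) (ae_restrict_of_ae hne)
            (hF2 z)).trans ?_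
          simp
      _ = ∫⁻ v in Set.Ioi z, ∫⁻ t in Set.Ioi v, F ((z, t), v) ∂ν ∂(hazardMeasure ν) := by
          have hm : Measurable fun v => ∫⁻ t in Set.Ioi v, F ((z, t), v) ∂ν := by
            have h3 : Measurable ({p : ℝ × ℝ | p.1 < p.2}.indicator
                fun p : ℝ × ℝ => F ((z, p.2), p.1)) :=
              hvt.indicator (measurableSet_lt measurable_fst measurable_snd)
            have h4 := h3.lintegral_prod_right' (ν := ν)
            convert! h4 using 2 with v
            rw [← lintegral_indicator measurableSet_Ioi]
            simp [Set.indicator]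
          rw [hazardMeasure, restrict_withDensity measurableSet_Ioi,
            lintegral_withDensity_eq_lintegral_mul _ (measurable_inv_measure_Ioi ν) hm]
          rfl
      _ = ∫⁻ v, ∫⁻ t, {p : ℝ × ℝ | z < p.1 ∧ p.1 < p.2}.indicator
            (fun p : ℝ × ℝ => F ((z, p.2), p.1)) (v, t) ∂ν ∂(hazardMeasure ν) := by
          rw [← lintegral_indicator measurableSet_Ioi]
          refine lintegral_congr fun v => ?_
          by_cases hv : z < v
          · rw [Set.indicator_of_mem (Set.mem_Ioi.2 hv), ← lintegral_indicator measurableSet_Ioi]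
            simp [Set.indicator, hv]
          · rw [Set.indicator_of_notMem (by simpa using hv)]
            simp [Set.indicator, hv]
      _ = ∫⁻ t, ∫⁻ v, {p : ℝ × ℝ | z < p.1 ∧ p.1 < p.2}.indicator
            (fun p : ℝ × ℝ => F ((z, p.2), p.1)) (v, t) ∂(hazardMeasure ν) ∂ν :=
          lintegral_lintegral_swap hind.aemeasurable
      _ = ∫⁻ t, ∫⁻ v in Set.Ioo z t, F ((z, t), v) ∂(hazardMeasure ν) ∂ν := by
          refine lintegral_congr fun t => ?_
          rw [← lintegral_indicator measurableSet_Ioo]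
          simp_rw [hsw]
  have h5 : Measurable fun t => ∫⁻ v in Set.Ioo z t, F ((z, t), v) ∂(hazardMeasure ν) := by
    have h4 := (hind.comp measurable_swap).lintegral_prod_right' (ν := hazardMeasure ν)
    convert! h4 using 2 with t
    rw [← lintegral_indicator measurableSet_Ioo]
    simp_rw [hsw]
    rfl
  rw [h2, lintegral_const_mul _ h5]

/-! ### The conditional law of a record given its neighbours -/

/-- The hazard measure conditioned to an interval, as a kernel in the end points. -/
noncomputable def intervalKernel (ν : Measure ℝ) [IsProbabilityMeasure ν] :
    Kernel (ℝ × ℝ) ℝ where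
  toFun p := ProbabilityTheory.cond (hazardMeasure ν) (Set.Ioo p.1 p.2)
  measurable' := by
    have hsec : ∀ A : Set ℝ, MeasurableSet A →
        Measurable fun p : ℝ × ℝ => hazardMeasure ν (Set.Ioo p.1 p.2 ∩ A) := by
      intro A hA
      have : MeasurableSet {q : (ℝ × ℝ) × ℝ | (q.1.1 < q.2 ∧ q.2 < q.1.2) ∧ q.2 ∈ A} :=
        ((measurableSet_lt measurable_fst.fst measurable_snd).inter
          (measurableSet_lt measurable_snd measurable_fst.snd)).inter (measurable_snd hA)
      exact measurable_measure_prodMk_left this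
    refine Measure.measurable_of_measurable_coe _ fun A hA => ?_
    simp_rw [cond_apply measurableSet_Ioo]
    have h := hsec Set.univ MeasurableSet.univ
    simp only [Set.inter_univ] at h
    exact h.inv.mul (hsec A hA)

theorem intervalKernel_apply (ν : Measure ℝ) [IsProbabilityMeasure ν] (p : ℝ × ℝ) :
    intervalKernel ν p = ProbabilityTheory.cond (hazardMeasure ν) (Set.Ioo p.1 p.2) := rfl

/-- Only finiteness holds: `cond` is the zero measure on intervals of zero or infinite hazard. -/
instance (ν : Measure ℝ) [IsProbabilityMeasure ν] : IsFiniteKernel (intervalKernel ν) :=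
  ⟨⟨1, ENNReal.one_lt_top, fun p => by
    rw [intervalKernel_apply, cond_apply measurableSet_Ioo, Set.inter_univ]
    exact ENNReal.inv_mul_le_one _⟩⟩

section Regression
variable {Ω : Type*} [MeasurableSpace Ω] (μ : Measure Ω) [IsProbabilityMeasure μ]
  (ν : Measure ℝ) [IsProbabilityMeasure ν] (X : ℕ → Ω → ℝ)

theorem lintegral_recordTime_triple (hmeas : ∀ i, Measurable (X i)) (hindep : iIndepFun X μ)
    (hlaw : ∀ i, μ.map (X i) = ν) (hc : Continuous (cdf ν)) (m : ℕ) :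
    (∀ k, AEMeasurable (fun ω => X (recordTime (fun i => X i ω) k) ω) μ) ∧
    ∀ F : (ℝ × ℝ) × ℝ → ENNReal, Measurable F →
      ∫⁻ ω, F ((X (recordTime (fun i => X i ω) m) ω, X (recordTime (fun i => X i ω) (m + 2)) ω),
          X (recordTime (fun i => X i ω) (m + 1)) ω) ∂μ =
        ∫⁻ s, ∫⁻ t, (ν (Set.Ioi s))⁻¹ * ∫⁻ v in Set.Ioo s t, F ((s, t), v) ∂(hazardMeasure ν)
          ∂ν ∂(recordLaw ν m) := by
  have hX : Measurable fun ω i => X i ω := measurable_pi_lambda _ hmeas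
  have hP : μ.map (fun ω i => X i ω) = iidLaw ν := by
    rw [(iIndepFun_iff_map_fun_eq_infinitePi_map hmeas).1 hindep]
    simp_rw [hlaw]
  have hae : ∀ᵐ ω ∂μ, ∀ k, (recordState k fun i => X i ω).1 =
      X (recordTime (fun i => X i ω) k) ω := by
    have h := ae_recordState_eq ν hc
    rw [← hP] at h
    exact ae_of_ae_map hX.aemeasurable h
  refine ⟨fun k => ?_, fun F hF => ?_⟩
  · refine AEMeasurable.congr ((measurable_recordState k).fst.comp hX).aemeasurable ?_
    filter_upwards [hae] with ω h using h k
  · have hFm : Measurable fun x => F (((recordState m x).1, (recordState (m + 2) x).1),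
        (recordState (m + 1) x).1) :=
      hF.comp (((measurable_recordState _).fst.prodMk (measurable_recordState _).fst).prodMk
        (measurable_recordState _).fst)
    rw [← lintegral_record_triple ν hc m hF, ← hP, lintegral_map hFm hX]
    refine lintegral_congr_ae ?_
    filter_upwards [hae] with ω h
    simp only [h]

theorem measurable_hazardMeasure_Ioo :
    Measurable fun p : ℝ × ℝ => hazardMeasure ν (Set.Ioo p.1 p.2) := by
  have : MeasurableSet {q : (ℝ × ℝ) × ℝ | q.1.1 < q.2 ∧ q.2 < q.1.2} :=
    (measurableSet_lt measurable_fst.fst measurable_snd).inter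
      (measurableSet_lt measurable_snd measurable_fst.snd)
  exact measurable_measure_prodMk_left this

/-- The regression of a record on the two adjacent ones, in terms of the hazard measure. -/
theorem hasRegression_record_iff (hmeas : ∀ i, Measurable (X i)) (hindep : iIndepFun X μ)
    (hlaw : ∀ i, μ.map (X i) = ν) (hc : Continuous (cdf ν)) (m : ℕ) (g : ℝ → ℝ) (a b : EReal)
    (φ : ℝ → ℝ → ℝ) :
    HasRegression μ g (fun ω => X (recordTime (fun i => X i ω) (m + 1)) ω)
        (fun ω => X (recordTime (fun i => X i ω) m) ω)
        (fun ω => X (recordTime (fun i => X i ω) (m + 2)) ω) a b φ ↔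
      ∀ᵐ p ∂(ν.prod ν), hazardMeasure ν (Set.Ioo p.1 p.2) ≠ 0 →
        a < (p.1 : EReal) → p.1 < p.2 → (p.2 : EReal) < b →
          Integrable g (ProbabilityTheory.cond (hazardMeasure ν) (Set.Ioo p.1 p.2)) ∧
            ∫ y, g y ∂(ProbabilityTheory.cond (hazardMeasure ν) (Set.Ioo p.1 p.2)) = φ p.1 p.2 := by
  obtain ⟨hR, htriple⟩ := lintegral_recordTime_triple μ ν X hmeas hindep hlaw hc m
  obtain ⟨-, hac, hca⟩ := map_recordState_and_recordLaw ν hc m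
  set U : Ω → ℝ := fun ω => X (recordTime (fun i => X i ω) m) ω
  set V : Ω → ℝ := fun ω => X (recordTime (fun i => X i ω) (m + 1)) ω
  set W : Ω → ℝ := fun ω => X (recordTime (fun i => X i ω) (m + 2)) ω
  have hUm : AEMeasurable U μ := hR _
  have hVm : AEMeasurable V μ := hR _
  have hWm : AEMeasurable W μ := hR _
  have hUW : AEMeasurable (fun ω => (U ω, W ω)) μ := hUm.prodMk hWm
  have hk : Measurable fun p : ℝ × ℝ =>
      (ν (Set.Ioi p.1))⁻¹ * hazardMeasure ν (Set.Ioo p.1 p.2) :=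
    ((measurable_inv_measure_Ioi ν).comp measurable_fst).mul (measurable_hazardMeasure_Ioo ν)
  have hJ : μ.map (fun ω => (U ω, W ω)) = ((recordLaw ν m).prod ν).withDensity
      fun p => (ν (Set.Ioi p.1))⁻¹ * hazardMeasure ν (Set.Ioo p.1 p.2) := by
    refine Measure.ext_of_lintegral _ fun f hf => ?_
    rw [lintegral_map' hf.aemeasurable hUW, lintegral_withDensity_eq_lintegral_mul _ hk hf,
      lintegral_prod _ (hk.mul hf).aemeasurable]
    refine (htriple (fun q => f q.1) (hf.comp measurable_fst)).trans ?_
    simp [mul_assoc, mul_comm]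
  have hcomp : μ.map (fun ω => ((U ω, W ω), V ω)) =
      μ.map (fun ω => (U ω, W ω)) ⊗ₘ intervalKernel ν := by
    refine Measure.ext_of_lintegral _ fun f hf => ?_
    have hf1 : Measurable fun p => ∫⁻ v, f (p, v) ∂(intervalKernel ν p) :=
      hf.lintegral_kernel_prod_right'
    rw [lintegral_map' hf.aemeasurable (hUW.prodMk hVm), Measure.lintegral_compProd hf,
      lintegral_map' hf1.aemeasurable hUW]
    -- The triple formula is applied to `f` and to its average over the kernel; the latter is
    -- constant in `v`, so the hazard of the interval cancels the normalisation.
    refine (htriple f hf).trans ((htriple (fun q => ∫⁻ v, f (q.1, v) ∂(intervalKernel ν q.1))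
      (hf1.comp measurable_fst)).trans ?_).symm
    refine lintegral_congr fun s => lintegral_congr_ae ?_
    filter_upwards [ae_cdf_mem_Ioo ν hc] with t ht
    congr 1
    rw [setLIntegral_const, intervalKernel_apply, ProbabilityTheory.cond, lintegral_smul_measure, smul_eq_mul]
    by_cases h0 : hazardMeasure ν (Set.Ioo s t) = 0
    · rw [h0, mul_zero, Measure.restrict_eq_zero.2 h0, lintegral_zero_measure]
    · rw [mul_comm, ← mul_assoc, ENNReal.mul_inv_cancel h0
        (hazardMeasure_Ioo_lt_top ν s ht.2).ne, one_mul]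
  have hκ := condDistrib_ae_eq_of_measure_eq_compProd (fun ω => (U ω, W ω)) hVm hcomp
  -- Mutual absolute continuity of the record law and `ν` removes the dependence on `m`.
  have hprod : ∀ P : ℝ × ℝ → Prop, (∀ᵐ p ∂((recordLaw ν m).prod ν), P p) ↔
      ∀ᵐ p ∂(ν.prod ν), P p := fun P =>
    ⟨fun h => hca.prod Measure.AbsolutelyContinuous.rfl h,
      fun h => hac.prod Measure.AbsolutelyContinuous.rfl h⟩
  have h1 : HasRegression μ g V U W a b φ ↔ ∀ᵐ p ∂(μ.map fun ω => (U ω, W ω)),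
      a < (p.1 : EReal) → p.1 < p.2 → (p.2 : EReal) < b →
          Integrable g (ProbabilityTheory.cond (hazardMeasure ν) (Set.Ioo p.1 p.2)) ∧
            ∫ y, g y ∂(ProbabilityTheory.cond (hazardMeasure ν) (Set.Ioo p.1 p.2)) = φ p.1 p.2 := by
    refine eventually_congr ?_
    filter_upwards [hκ] with p hp
    rw [hp, intervalKernel_apply]
  rw [h1, hJ, ae_withDensity_iff hk, hprod]
  refine eventually_congr (Eventually.of_forall fun p => ?_)
  have : (ν (Set.Ioi p.1))⁻¹ ≠ 0 := ENNReal.inv_ne_zero.2 (measure_ne_top _ _)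
  simp [this]

end Regression

/-! ### The functional equation for the hazard function -/

theorem nullSingletonClass_of_continuous_cdf (ν : Measure ℝ) [IsProbabilityMeasure ν]
    (hc : Continuous (cdf ν)) : NullSingletonClass ν := by
  refine ⟨fun x => measure_mono_null ?_ (ae_iff.1 (ae_cdf_ne ν hc (cdf ν x)))⟩
  rintro y rfl
  simp

theorem nullSingletonClass_hazardMeasure (ν : Measure ℝ) [IsProbabilityMeasure ν]
    (hc : Continuous (cdf ν)) : NullSingletonClass (hazardMeasure ν) := by
  have := nullSingletonClass_of_continuous_cdf ν hc
  exact ⟨fun x => withDensity_absolutelyContinuous _ _ (measure_singleton x)⟩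

/-- On the interval `g` lies between `0` and `g s`, and the hazard is finite. -/
theorem integrableOn_hazardMeasure_Ioo (ν : Measure ℝ) [IsProbabilityMeasure ν] {g : ℝ → ℝ}
    {I : Set ℝ} (hI : I.OrdConnected) (hI1 : ∀ x ∈ I, cdf ν x < 1) (hg : StrictAntiOn g I)
    (hpos : ∀ x ∈ I, 0 < g x) {s t : ℝ} (hs : s ∈ I) (ht : t ∈ I) :
    IntegrableOn g (Set.Ioo s t) (hazardMeasure ν) := by
  have hsub : Set.Ioo s t ⊆ I := fun v hv => hI.out hs ht ⟨hv.1.le, hv.2.le⟩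
  have : IsFiniteMeasure ((hazardMeasure ν).restrict (Set.Ioo s t)) :=
    ⟨by simpa using hazardMeasure_Ioo_lt_top ν s (hI1 t ht)⟩
  refine Integrable.of_bound
    (aemeasurable_restrict_of_antitoneOn measurableSet_Ioo
      (hg.antitoneOn.mono hsub)).aestronglyMeasurable (g s) ?_
  refine ae_restrict_of_forall_mem measurableSet_Ioo fun v hv => ?_
  rw [Real.norm_of_nonneg (hpos v (hsub hv)).le]
  exact (hg hs (hsub hv) hv.1).le

theorem integral_cond_hazardMeasure (ν : Measure ℝ) [IsProbabilityMeasure ν]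
    (hc : Continuous (cdf ν)) (g : ℝ → ℝ) {s t : ℝ} (hst : s ≤ t) (ht : cdf ν t < 1) :
    ∫ y, g y ∂(ProbabilityTheory.cond (hazardMeasure ν) (Set.Ioo s t)) =
      (Real.log (1 - cdf ν s) - Real.log (1 - cdf ν t))⁻¹ *
        ∫ y in Set.Ioo s t, g y ∂(hazardMeasure ν) := by
  rw [ProbabilityTheory.cond, integral_smul_measure, smul_eq_mul, ENNReal.toReal_inv,
    ← hazardMeasure_real_Ioo ν hc hst ht, Measure.real]

/-- An additive function `k` of intervals, `h` its counterpart, with `k = 2 h / (w + w')` on the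
three intervals of three points: the increments of `h` are proportional to those of `w ^ 2`. -/
theorem sq_proportional_of_three_points {Ks Kr Kt Hs Hr Ht ws wr wt : ℝ}
    (h1 : (Kr - Ks) * (ws + wr) = 2 * (Hr - Hs)) (h2 : (Kt - Kr) * (wr + wt) = 2 * (Ht - Hr))
    (h3 : (Kt - Ks) * (ws + wt) = 2 * (Ht - Hs)) :
    (Hr - Hs) * (wt ^ 2 - wr ^ 2) = (Ht - Hr) * (wr ^ 2 - ws ^ 2) := by
  have h4 : (Kr - Ks) * (wt - wr) = (Kt - Kr) * (wr - ws) := by linear_combination h3 - h1 - h2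
  linear_combination (-(wt ^ 2 - wr ^ 2) / 2) * h1 + ((wr ^ 2 - ws ^ 2) / 2) * h2 +
    ((ws + wr) * (wt + wr) / 2) * h4

theorem log_one_sub_cdf_lt {ν : Measure ℝ} {x y : ℝ} (h : cdf ν x < cdf ν y)
    (hy : cdf ν y < 1) : -Real.log (1 - cdf ν x) < -Real.log (1 - cdf ν y) :=
  neg_lt_neg (Real.log_lt_log (by linarith) (by linarith))

theorem ordConnected_cdf_mem_Ioo (ν : Measure ℝ) :
    {x | 0 < cdf ν x ∧ cdf ν x < 1}.OrdConnected :=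
  ⟨fun _ hx _ hy _ hz =>
    ⟨hx.1.trans_le (monotone_cdf ν hz.1), (monotone_cdf ν hz.2).trans_lt hy.2⟩⟩

section Characterization
variable (ν : Measure ℝ) [IsProbabilityMeasure ν] (hc : Continuous (cdf ν)) {g : ℝ → ℝ}
  (hg : StrictAntiOn g {x | 0 < cdf ν x ∧ cdf ν x < 1})
  (hpos : ∀ x, 0 < cdf ν x → cdf ν x < 1 → 0 < g x)
include hc hg hpos

/-- The functional equation for the hazard function, in a form symmetric in the two points. -/
theorem exists_primitive_of_regression
    (hreg : ∀ᵐ p ∂(ν.prod ν), 0 < cdf ν p.1 → p.1 < p.2 → cdf ν p.2 < 1 →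
      ∫ y in Set.Ioo p.1 p.2, g y ∂(hazardMeasure ν) =
        (Real.log (1 - cdf ν p.1) - Real.log (1 - cdf ν p.2)) *
          (2 * g p.1 * g p.2 / (g p.1 + g p.2))) :
    ∃ K : ℝ → ℝ, ∀ᵐ p ∂(ν.prod ν), 0 < cdf ν p.1 → cdf ν p.1 < 1 → 0 < cdf ν p.2 →
      cdf ν p.2 < 1 → (K p.2 - K p.1) * ((g p.1)⁻¹ + (g p.2)⁻¹) =
        2 * (-Real.log (1 - cdf ν p.2) - -Real.log (1 - cdf ν p.1)) := by
  have := nullSingletonClass_hazardMeasure ν hc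
  obtain ⟨x₀, hx₀⟩ := exists_cdf_eq ν hc (u := 1 / 2) (by norm_num) (by norm_num)
  have hx₀I : x₀ ∈ {x | 0 < cdf ν x ∧ cdf ν x < 1} := by
    constructor <;> rw [hx₀] <;> norm_num
  have hint : ∀ s ∈ {x | 0 < cdf ν x ∧ cdf ν x < 1}, ∀ t ∈ {x | 0 < cdf ν x ∧ cdf ν x < 1},
      IntervalIntegrable g (hazardMeasure ν) s t := by
    intro s hs t ht
    have hI := ordConnected_cdf_mem_Ioo ν
    constructor <;> rw [integrableOn_Ioc_iff_integrableOn_Ioo] <;>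
      apply integrableOn_hazardMeasure_Ioo ν hI (fun x hx => hx.2) hg
        (fun x hx => hpos x hx.1 hx.2) <;> assumption
  have hK : ∀ p : ℝ × ℝ, (0 < cdf ν p.1 → p.1 < p.2 → cdf ν p.2 < 1 →
      ∫ y in Set.Ioo p.1 p.2, g y ∂(hazardMeasure ν) =
        (Real.log (1 - cdf ν p.1) - Real.log (1 - cdf ν p.2)) *
          (2 * g p.1 * g p.2 / (g p.1 + g p.2))) → p.1 < p.2 →
      0 < cdf ν p.1 → cdf ν p.1 < 1 → 0 < cdf ν p.2 → cdf ν p.2 < 1 →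
      ((∫ y in x₀..p.2, g y ∂(hazardMeasure ν)) - ∫ y in x₀..p.1, g y ∂(hazardMeasure ν)) *
          ((g p.1)⁻¹ + (g p.2)⁻¹) =
        2 * (-Real.log (1 - cdf ν p.2) - -Real.log (1 - cdf ν p.1)) := by
    intro p hp hlt h1 h2 h3 h4
    rw [intervalIntegral.integral_interval_sub_left (hint _ hx₀I _ ⟨h3, h4⟩)
      (hint _ hx₀I _ ⟨h1, h2⟩), intervalIntegral.integral_of_le hlt.le,
      integral_Ioc_eq_integral_Ioo, hp h1 hlt h4]
    have hg1 := hpos _ h1 h2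
    have hg2 := hpos _ h3 h4
    have hsum : g p.1 + g p.2 ≠ 0 := by positivity
    field_simp
    ring
  refine ⟨fun t => ∫ y in x₀..t, g y ∂(hazardMeasure ν), ?_⟩
  -- The hypothesis concerns ordered pairs only; symmetry under exchange lets the three points below
  -- be used in any order.
  have hswap := (Measure.measurePreserving_swap (μ := ν) (ν := ν)).quasiMeasurePreserving.ae hreg
  filter_upwards [hreg, hswap] with p hp hp' h1 h2 h3 h4
  rcases lt_trichotomy p.1 p.2 with hlt | heq | hlt
  · exact hK p hp hlt h1 h2 h3 h4
  · rw [heq]; ring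
  · have := hK p.swap hp' hlt h3 h4 h1 h2
    simp only [Prod.fst_swap, Prod.snd_swap] at this
    linear_combination -this

/-- The regression identity makes the hazard function affine in `g ^ (-2)` at almost all points. -/
theorem exists_ae_hazard_affine
    (hreg : ∀ᵐ p ∂(ν.prod ν), 0 < cdf ν p.1 → p.1 < p.2 → cdf ν p.2 < 1 →
      ∫ y in Set.Ioo p.1 p.2, g y ∂(hazardMeasure ν) =
        (Real.log (1 - cdf ν p.1) - Real.log (1 - cdf ν p.2)) *
          (2 * g p.1 * g p.2 / (g p.1 + g p.2))) :
    ∃ c d : ℝ, 0 < c ∧ ∀ᵐ t ∂ν, 0 < cdf ν t → cdf ν t < 1 →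
      -Real.log (1 - cdf ν t) = c * (g t)⁻¹ ^ 2 + d := by
  obtain ⟨K, hK⟩ := exists_primitive_of_regression ν hc hg hpos hreg
  have hK2 := Measure.ae_ae_of_ae_prod hK
  -- By Fubini, `s` and then `r` are fixed with good sections and with the pair `(s, r)` good.
  -- Taking `cdf ν s < cdf ν r` makes both increments, hence `c`, positive.
  obtain ⟨s, hs0, hs1, hs⟩ := exists_cdf_mem_Ioo_of_ae ν hc one_pos le_rfl le_rfl hK2
  obtain ⟨r, hsr, hr1, hr, hr'⟩ := exists_cdf_mem_Ioo_of_ae ν hc hs1 hs0.le le_rfl (hK2.and hs)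
  have hr0 : 0 < cdf ν r := hs0.trans hsr
  have hHlt := log_one_sub_cdf_lt hsr hr1
  have hglt : g r < g s := hg ⟨hs0, hs1⟩ ⟨hr0, hr1⟩ (lt_of_cdf_lt hsr)
  have hgr := hpos r hr0 hr1
  have hgs := hpos s hs0 hs1
  have hw : (g s)⁻¹ ^ 2 < (g r)⁻¹ ^ 2 :=
    pow_lt_pow_left₀ (inv_strictAnti₀ hgr hglt) (by positivity) two_ne_zero
  set Hs := -Real.log (1 - cdf ν s)
  set Hr := -Real.log (1 - cdf ν r)
  have hden : (g r)⁻¹ ^ 2 - (g s)⁻¹ ^ 2 ≠ 0 := by linarith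
  refine ⟨(Hr - Hs) / ((g r)⁻¹ ^ 2 - (g s)⁻¹ ^ 2),
    Hr - (Hr - Hs) / ((g r)⁻¹ ^ 2 - (g s)⁻¹ ^ 2) * (g r)⁻¹ ^ 2,
    div_pos (by linarith) (by linarith), ?_⟩
  filter_upwards [hs, hr] with t hst hrt ht0 ht1
  have h := sq_proportional_of_three_points (hr' hs0 hs1 hr0 hr1) (hrt hr0 hr1 ht0 ht1)
    (hst hs0 hs1 ht0 ht1)
  have h' : -Real.log (1 - cdf ν t) - Hr =
      (Hr - Hs) / ((g r)⁻¹ ^ 2 - (g s)⁻¹ ^ 2) * ((g t)⁻¹ ^ 2 - (g r)⁻¹ ^ 2) := by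
    rw [div_mul_eq_mul_div, eq_div_iff hden]
    exact h.symm
  linear_combination h'

/-- Good points `y` are chosen with `cdf ν y` close to `cdf ν x` on either side. There the
right-hand side is monotone and the left-hand side is continuous in the value of `cdf ν`, which
squeezes the identity at `x`. -/
theorem hazard_affine_of_ae {c d : ℝ}
    (hcpos : 0 < c) (h : ∀ᵐ t ∂ν, 0 < cdf ν t → cdf ν t < 1 →
      -Real.log (1 - cdf ν t) = c * (g t)⁻¹ ^ 2 + d) {x : ℝ} (hx0 : 0 < cdf ν x)
    (hx1 : cdf ν x < 1) : -Real.log (1 - cdf ν x) = c * (g x)⁻¹ ^ 2 + d := by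
  have hmono : ∀ y z, 0 < cdf ν y → cdf ν y < cdf ν z → cdf ν z < 1 →
      c * (g y)⁻¹ ^ 2 + d ≤ c * (g z)⁻¹ ^ 2 + d := by
    intro y z hy hyz hz
    have hgz := hpos z (hy.trans hyz) hz
    have hgy := hpos y hy (hyz.trans hz)
    have hlt : g z < g y := hg ⟨hy, hyz.trans hz⟩ ⟨hy.trans hyz, hz⟩ (lt_of_cdf_lt hyz)
    gcongr
  have hcont : ContinuousAt (fun u : ℝ => -Real.log (1 - u)) (cdf ν x) :=
    ((continuousAt_const.sub continuousAt_id).log (sub_pos.2 hx1).ne').neg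
  apply le_antisymm
  · refine le_of_tendsto (hcont.tendsto.mono_left (nhdsWithin_le_nhds (s := Set.Iio (cdf ν x)))) ?_
    filter_upwards [Ioo_mem_nhdsLT hx0] with u hu
    obtain ⟨y, huy, hyx, hy⟩ := exists_cdf_mem_Ioo_of_ae ν hc hu.2 hu.1.le hx1.le h
    have hy0 : 0 < cdf ν y := hu.1.trans huy
    calc -Real.log (1 - u) ≤ -Real.log (1 - cdf ν y) :=
          neg_le_neg (Real.log_le_log (by linarith) (by linarith))
      _ ≤ c * (g x)⁻¹ ^ 2 + d := by
          rw [hy hy0 (hyx.trans hx1)]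
          exact hmono y x hy0 hyx hx1
  · refine ge_of_tendsto (hcont.tendsto.mono_left (nhdsWithin_le_nhds (s := Set.Ioi (cdf ν x)))) ?_
    filter_upwards [Ioo_mem_nhdsGT hx1] with u hu
    obtain ⟨y, hxy, hyu, hy⟩ := exists_cdf_mem_Ioo_of_ae ν hc hu.1 hx0.le hu.2.le h
    have hy1 : cdf ν y < 1 := hyu.trans hu.2
    calc c * (g x)⁻¹ ^ 2 + d ≤ -Real.log (1 - cdf ν y) := by
          rw [hy (hx0.trans hxy) hy1]
          exact hmono x y hx0 hxy hy1
      _ ≤ -Real.log (1 - u) :=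
          neg_le_neg (Real.log_le_log (by linarith [hu.2]) (by linarith))

omit hg in
/-- If the hazard function is affine in `g ^ (-2)`, the regression identity holds. -/
theorem setIntegral_hazardMeasure_of_affine {c d : ℝ} (hcpos : 0 < c)
    (h : ∀ x, 0 < cdf ν x → cdf ν x < 1 → -Real.log (1 - cdf ν x) = c * (g x)⁻¹ ^ 2 + d)
    {s t : ℝ} (hs : 0 < cdf ν s) (hst : s < t) (ht : cdf ν t < 1) :
    ∫ y in Set.Ioo s t, g y ∂(hazardMeasure ν) = 2 * c * ((g t)⁻¹ - (g s)⁻¹) := by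
  have hle := monotone_cdf ν hst.le
  have hs1 : cdf ν s < 1 := hle.trans_lt ht
  have ht0 : 0 < cdf ν t := hs.trans_le hle
  have hgs := hpos s hs hs1
  have hgt := hpos t ht0 ht
  -- Solving the affine relation for `w ^ 2` as a function of `u = cdf ν x` gives `g = 1 / √(q u)`;
  -- the integrand then has primitive `2 c √(q u)`.
  set q : ℝ → ℝ := fun u => (-Real.log (1 - u) - d) / c with hq
  have hqG : ∀ x, 0 < cdf ν x → cdf ν x < 1 → √(q (cdf ν x)) = (g x)⁻¹ := by
    intro x h0 h1
    have : q (cdf ν x) = (g x)⁻¹ ^ 2 := by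
      simp only [hq, h x h0 h1]
      field_simp
      ring
    rw [this, Real.sqrt_sq (inv_pos.2 (hpos x h0 h1)).le]
  have hqpos : ∀ u, cdf ν s ≤ u → u < 1 → 0 < q u := by
    intro u hu hu1
    have h1 : -Real.log (1 - cdf ν s) ≤ -Real.log (1 - u) :=
      neg_le_neg (Real.log_le_log (by linarith) (by linarith))
    have h2 : 0 < c * (g s)⁻¹ ^ 2 := by positivity
    rw [h s hs hs1] at h1
    exact div_pos (by linarith) hcpos
  have hqd : ∀ u, u < 1 → HasDerivAt q ((1 - u)⁻¹ / c) u := by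
    intro u hu
    have hu1 : 1 - u ≠ 0 := by linarith
    convert! (((((hasDerivAt_id u).const_sub 1).log hu1).neg).sub_const d).div_const c using 1
    simp [neg_div]
  have hφ : ContinuousOn (fun u => (√(q u))⁻¹) (Set.Icc (cdf ν s) (cdf ν t)) := by
    intro u hu
    have hu1 : u < 1 := hu.2.trans_lt ht
    refine ContinuousAt.continuousWithinAt ?_
    exact ((hqd u hu1).continuousAt.sqrt).inv₀ (Real.sqrt_pos.2 (hqpos u hu.1 hu1)).ne'
  have h1 : ∫ y in Set.Ioo s t, g y ∂(hazardMeasure ν) =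
      ∫ y in Set.Ioo s t, (√(q (cdf ν y)))⁻¹ ∂(hazardMeasure ν) := by
    refine setIntegral_congr_fun measurableSet_Ioo fun y hy => ?_
    rw [hqG y (hs.trans_le (monotone_cdf ν hy.1.le)) ((monotone_cdf ν hy.2.le).trans_lt ht),
      inv_inv]
  rw [h1, setIntegral_hazardMeasure_comp_cdf ν hc ht (fun u => (√(q u))⁻¹)
    (hφ.mono Set.Ioo_subset_Icc_self), ← integral_Ioc_eq_integral_Ioo,
    ← intervalIntegral.integral_of_le hle]
  have hd : ∀ u ∈ Set.uIcc (cdf ν s) (cdf ν t),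
      HasDerivAt (fun u => 2 * c * √(q u)) ((1 - u)⁻¹ * (√(q u))⁻¹) u := by
    intro u hu
    rw [Set.uIcc_of_le hle] at hu
    have hu1 : u < 1 := hu.2.trans_lt ht
    have h2 := (Real.sqrt_pos.2 (hqpos u hu.1 hu1)).ne'
    have hu2 : 1 - u ≠ 0 := by linarith
    convert! ((hqd u hu1).sqrt (hqpos u hu.1 hu1).ne').const_mul (2 * c) using 1
    field_simp
  rw [intervalIntegral.integral_eq_sub_of_hasDerivAt hd, hqG t ht0 ht, hqG s hs hs1]
  · ring
  · refine ContinuousOn.intervalIntegrable ?_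
    rw [Set.uIcc_of_le hle]
    refine ContinuousOn.mul (ContinuousOn.inv₀ (by fun_prop) fun u hu => ?_) hφ
    have := hu.2
    linarith

end Characterization

/-! ### Positivity of `g` and the characterization -/

/-- A strictly decreasing function whose reciprocal square is strictly increasing is positive on
the open set where a continuous distribution function is neither `0` nor `1`. -/
theorem pos_of_strictAntiOn_of_strictMonoOn (ν : Measure ℝ) [IsProbabilityMeasure ν]
    (hc : Continuous (cdf ν)) {g : ℝ → ℝ}
    (hg : StrictAntiOn g {x | 0 < cdf ν x ∧ cdf ν x < 1})
    (hT : StrictMonoOn (fun y => g y ^ (-2 : ℤ)) {x | 0 < cdf ν x ∧ cdf ν x < 1}) (x : ℝ)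
    (h0 : 0 < cdf ν x) (h1 : cdf ν x < 1) : 0 < g x := by
  obtain ⟨y, hy⟩ := exists_cdf_eq ν hc (u := cdf ν x / 2) (by linarith) (by linarith)
  obtain ⟨z, hz⟩ := exists_cdf_eq ν hc (u := (cdf ν x + 1) / 2) (by linarith) (by linarith)
  have hyx : y < x := lt_of_cdf_lt (ν := ν) (by linarith)
  have hxz : x < z := lt_of_cdf_lt (ν := ν) (by linarith)
  have hyI : y ∈ {x | 0 < cdf ν x ∧ cdf ν x < 1} := ⟨by linarith, by linarith⟩
  have hzI : z ∈ {x | 0 < cdf ν x ∧ cdf ν x < 1} := ⟨by linarith, by linarith⟩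
  have hxI : x ∈ {x | 0 < cdf ν x ∧ cdf ν x < 1} := ⟨h0, h1⟩
  have hT' : ∀ u, g u ^ (-2 : ℤ) = (g u ^ 2)⁻¹ := fun u => by
    rw [zpow_neg]; norm_cast
  have hT1 := hT hyI hxI hyx
  have hT2 := hT hxI hzI hxz
  simp only [hT'] at hT1 hT2
  -- The left neighbour excludes `g x = 0`, where the inverse would be `0` by convention. The right
  -- one excludes `g x < 0`, since `g z < g x < 0` would give a larger square at `z`.
  have hx2 : 0 < (g x ^ 2)⁻¹ := (inv_nonneg.2 (sq_nonneg (g y))).trans_lt hT1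
  have hlt : g z ^ 2 < g x ^ 2 := (inv_lt_inv₀ (inv_pos.1 hx2) (inv_pos.1 (hx2.trans hT2))).1 hT2
  have hgxz := hg hxI hzI hxz
  by_contra! hneg
  nlinarith

theorem corollary3 {Ω : Type*} [MeasurableSpace Ω] (μ : Measure Ω) [IsProbabilityMeasure μ]
    -- `X 0, X 1, …` are independent copies of a random variable with law `ν`
    (ν : Measure ℝ) [IsProbabilityMeasure ν] (X : ℕ → Ω → ℝ)
    (hmeas : ∀ i, Measurable (X i)) (hindep : iIndepFun X μ) (hlaw : ∀ i, μ.map (X i) = ν)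
    -- their common distribution function is continuous
    (G : ℝ → ℝ) (hG : G = fun y => cdf ν y) (hGcont : Continuous G)
    (g T : ℝ → ℝ) (τ : ℝ)
    (hg : StrictAntiOn g (openInterval (leftExtremity G) (rightExtremity G)))
    (hT : T = fun y => g y ^ (-2 : ℤ))
    (hTcont : ContinuousOn T (openInterval (leftExtremity G) (rightExtremity G)))
    (hTmono : StrictMonoOn T (openInterval (leftExtremity G) (rightExtremity G)))
    (hTleft : Tendsto T (rightLimitFilter (leftExtremity G)) (𝓝 τ))
    (hTright : Tendsto T (leftLimitFilter (rightExtremity G)) atTop)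
    (n : ℕ) (hn : 2 ≤ n) :
    HasRegression μ g
        (fun ω => recordValue (fun i => X i ω) n)
        (fun ω => recordValue (fun i => X i ω) (n - 1))
        (fun ω => recordValue (fun i => X i ω) (n + 1))
        (leftExtremity G) (rightExtremity G)
        (fun s t => 2 * g s * g t / (g s + g t)) ↔
      ∃ c : ℝ, 0 < c ∧
        ∀ y ∈ openInterval (leftExtremity G) (rightExtremity G),
          G y = 1 - Real.exp (-c * (g y ^ (-2 : ℤ) - τ)) := by
  subst hG hT
  have hc : Continuous (cdf ν) := hGcont
  have hI := openInterval_extremities_eq ν hc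
  have hmem : ∀ y, 0 < cdf ν y → cdf ν y < 1 →
      (leftExtremity fun y => cdf ν y) < (y : EReal) ∧
        (y : EReal) < rightExtremity fun y => cdf ν y := fun y h0 h1 =>
    hI.symm.subset (⟨h0, h1⟩ : y ∈ {x | 0 < cdf ν x ∧ cdf ν x < 1})
  rw [hI] at hg hTmono ⊢
  have hpos := pos_of_strictAntiOn_of_strictMonoOn ν hc hg hTmono
  have hz : ∀ y, g y ^ (-2 : ℤ) = (g y)⁻¹ ^ 2 := fun y => by
    rw [zpow_neg, inv_pow]; norm_cast
  simp only [hz] at hTleft ⊢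
  -- Counted from `0`, the records `n - 1`, `n`, `n + 1` have numbers `m`, `m + 1`, `m + 2`.
  obtain ⟨m, rfl⟩ : ∃ m, n = m + 2 := ⟨n - 2, by omega⟩
  refine (hasRegression_record_iff μ ν X hmeas hindep hlaw hc m g _ _ _).trans ⟨fun h => ?_, ?_⟩
  · obtain ⟨c, d, hcpos, hae⟩ := exists_ae_hazard_affine ν hc hg hpos (by
      filter_upwards [h] with p hp h0 hlt h1
      have hp0 : cdf ν p.1 < 1 := (monotone_cdf ν hlt.le).trans_lt h1
      have hp1 : 0 < cdf ν p.2 := h0.trans_le (monotone_cdf ν hlt.le)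
      -- Across a gap of `ν` the regression says nothing, but both sides of the integrated identity
      -- vanish.
      by_cases hz0 : hazardMeasure ν (Set.Ioo p.1 p.2) = 0
      · rw [← hazardMeasure_real_Ioo ν hc hlt.le h1, Measure.real, hz0,
          Measure.restrict_eq_zero.2 hz0]
        simp
      · have hreal : (hazardMeasure ν).real (Set.Ioo p.1 p.2) ≠ 0 :=
          ENNReal.toReal_ne_zero.2 ⟨hz0, (hazardMeasure_Ioo_lt_top ν p.1 h1).ne⟩
        have h2 := (hp hz0 (hmem _ h0 hp0).1 hlt (hmem _ hp1 h1).2).2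
        rw [integral_cond_hazardMeasure ν hc g hlt.le h1,
          ← hazardMeasure_real_Ioo ν hc hlt.le h1] at h2
        rw [← h2, ← hazardMeasure_real_Ioo ν hc hlt.le h1, mul_inv_cancel_left₀ hreal])
    have haff := fun x h0 h1 =>
      hazard_affine_of_ae ν hc hg hpos hcpos hae (x := x) h0 h1
    -- Both sides of the affine relation are compared in the limit at the left extremity.
    have hd : 0 = c * τ + d := by
      have := rightLimitFilter_neBot (leftExtremity_cdf_ne_top ν)
      have hG0 := tendsto_cdf_rightLimitFilter ν hc
      have hcont : ContinuousAt (fun u : ℝ => -Real.log (1 - u)) 0 :=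
        ((continuousAt_const.sub continuousAt_id).log (by simp)).neg
      have hl : Tendsto (fun y => -Real.log (1 - cdf ν y))
          (rightLimitFilter (leftExtremity fun y => cdf ν y)) (𝓝 0) := by
        have h3 := hcont.tendsto.comp (hG0.mono_right nhdsWithin_le_nhds)
        simpa [Function.comp_def] using h3
      have hr := (hTleft.const_mul c).add_const d
      refine tendsto_nhds_unique (hl.congr' ?_) hr
      filter_upwards [hG0 (Ioo_mem_nhdsGT one_pos)] with y hy using haff y hy.1 hy.2
    refine ⟨c, hcpos, fun y hy => ?_⟩
    have h4 : -c * ((g y)⁻¹ ^ 2 - τ) = Real.log (1 - cdf ν y) := by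
      linear_combination haff y hy.1 hy.2 - hd
    rw [h4, Real.exp_log (by linarith [hy.2])]
    ring
  · rintro ⟨c, hcpos, hGc⟩
    have haff : ∀ x, 0 < cdf ν x → cdf ν x < 1 →
        -Real.log (1 - cdf ν x) = c * (g x)⁻¹ ^ 2 + -(c * τ) := by
      intro x h0 h1
      rw [hGc x ⟨h0, h1⟩, sub_sub_cancel, Real.log_exp]
      ring
    refine Eventually.of_forall fun p hz0 ha hlt hb => ?_
    have h0 : 0 < cdf ν p.1 :=
      (hI.subset (⟨ha, (EReal.coe_lt_coe_iff.2 hlt).trans hb⟩ : p.1 ∈ openInterval _ _)).1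
    have h1 : cdf ν p.2 < 1 :=
      (hI.subset (⟨ha.trans (EReal.coe_lt_coe_iff.2 hlt), hb⟩ : p.2 ∈ openInterval _ _)).2
    have hp0 : cdf ν p.1 < 1 := (monotone_cdf ν hlt.le).trans_lt h1
    have hp1 : 0 < cdf ν p.2 := h0.trans_le (monotone_cdf ν hlt.le)
    refine ⟨?_, ?_⟩
    · exact (integrableOn_hazardMeasure_Ioo ν (ordConnected_cdf_mem_Ioo ν) (fun x hx => hx.2) hg
        (fun x hx => hpos x hx.1 hx.2) ⟨h0, hp0⟩ ⟨hp1, h1⟩).integrable.smul_measure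
        (ENNReal.inv_ne_top.2 hz0)
    · have hg1 := hpos _ h0 hp0
      have hg2 := hpos _ hp1 h1
      have hglt := hg ⟨h0, hp0⟩ ⟨hp1, h1⟩ hlt
      have hw : (g p.1)⁻¹ < (g p.2)⁻¹ := inv_strictAnti₀ hg2 hglt
      -- The difference of squares is factored so that the increment of `1 / g` cancels against the
      -- integral.
      have hH : Real.log (1 - cdf ν p.1) - Real.log (1 - cdf ν p.2) =
          c * (((g p.2)⁻¹ - (g p.1)⁻¹) * ((g p.2)⁻¹ + (g p.1)⁻¹)) := by
        linear_combination haff _ hp1 h1 - haff _ h0 hp0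
      rw [integral_cond_hazardMeasure ν hc g hlt.le h1, hH,
        setIntegral_hazardMeasure_of_affine ν hc hpos hcpos haff h0 hlt h1]
      have hne : (g p.2)⁻¹ - (g p.1)⁻¹ ≠ 0 := by linarith
      have hcne := hcpos.ne'
      have hsum : (g p.2)⁻¹ + (g p.1)⁻¹ = (g p.1 + g p.2) / (g p.1 * g p.2) := by
        field_simp
      have hsum0 : g p.1 + g p.2 ≠ 0 := by positivity
      rw [hsum]
      generalize (g p.2)⁻¹ - (g p.1)⁻¹ = D at hne
      field_simp
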